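/- Let $k$ be a field and $A$ a nonzero unital associative $k$-algebra, not necessarily finite dimensional (tensor products are over $k$). Let $R=\sum R^1\otimes R^2\in A\otimes A$ be an invertible element with $R^{12}R^{13}R^{23}=R^{23}R^{12}$ in $A\otimes A\otimes A$ (the pentagon equation). Put $$P=P(A,R)=\Big\{\sum\langle\varphi,R^2\rangle R^1 : \varphi\in A^*\Big\},\qquad H=H(A,R)=\Big\{\sum\langle\varphi,R^1\rangle R^2 : \varphi\in A^*\Big\},$$ and assume that $R$ is unitary, i.e. $1_A\in P\cap H$. Let $l(R)$ be the least $m$ such that $R$ is a sum of $m$ elementary tensors, and put $$A^{R,l}=\{a\in A : R(a\otimes 1)=a\otimes 1\},\qquad A^{R,r}=\{a\in A : (1\otimes a)R=1\otimes a\}.$$ For a finite dimensional Hopf algebra $L$, $L^*$ is the dual Hopf algebra (product $\langle p q,x\rangle=\langle p,x_{(1)}\rangle\langle q,x_{(2)}\rangle$, coproduct transpose to the multiplication of $L$), and the Heisenberg double $\mathcal H(L)=L\# L^*$ is $L\otimes L^*$ with multiplication $(h\# p)(g\# q)=h_{(2)}g\# p\,(h_{(1)}\cdot q)$, where $\langle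 h\cdot q,x\rangle=\langle q,xh\rangle$; its canonical element is $\mathcal R=\sum_i(e_i\#\varepsilon)\otimes(1\# e_i^*)$, for a basis $(e_i)$ of $L$ with dual basis $(e_i^*)$. Then: 1) $P$ and $H$ are finite dimensional unital subalgebras of $A$, and they are Hopf algebras with the comultiplications $$\Delta_P(x)=R^{-1}(1\otimes x)R\quad(x\in P),\qquad \Delta_H(y)=R(y\otimes 1)R^{-1}\quad(y\in H).$$ The subalgebra $A_R$ of $A$ generated by $P$ and $H$ is finite dimensional, and $\dim A_R\le l(R)^2$. 2) $R\in P\otimes H$, and $f:P^*\to H$, $f(p^*)=\sum\langle p^*,R^1\rangle R^2$, is an isomorphism of Hopf algebras. 3) The linear map $F:\mathcal H(P)\to A$, $F(p\# p^*)=\sum\langle p^*,R^1\rangle R^2p$, is an algebra map, and $R=(F\otimes F)(\mathcal R)$, where $\mathcal R$ is the canonical element of $\mathcal H(P)\otimes\mathcal H(P)$. 4) The multiplication of $A$ defines isomorphisms $A^{R,r}\otimes P\cong A$ of right $P$-modules and $H\otimes A^{R,l}\cong A$ of left $H$-modules. In particular $A$ is free as a right $P$-module and as a left $H$-module. If $A$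 is finite dimensional, then $A^{R,l}$ and $A^{R,r}$ are nonzero and $$\dim P=\dim H=\frac{\dim A}{\dim A^{R,l}}=\frac{\dim A}{\dim A^{R,r}}.$$ 5) If $f:A\to B$ is an isomorphism of $k$-algebras and $S=(f\otimes f)(R)$, then the coefficient space $P(B,S)$ is likewise a subalgebra of $B$ and a Hopf algebra with comultiplication $x\mapsto S^{-1}(1\otimes x)S$, and the Hopf algebras $P(A,R)$ and $P(B,S)$ are isomorphic. In particular, for every invertible $u\in A$, the Hopf algebras $P(A,R)$ and $P(A,(u\otimes u)R(u\otimes u)^{-1})$ are isomorphic. -/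

import Mathlib

open scoped TensorProduct

noncomputable section

namespace PentagonEq

universe u v

/-! ### The dual of a finite dimensional Hopf algebra -/

section Dual

open Coalgebra

/-- The dual `L^*` of a bialgebra `L`. -/
def HopfDual (k : Type u) (L : Type v) [Field k] [Ring L] [Bialgebra k L] : Type (max u v) :=
  WithConv (L →ₗ[k] k)

variable {k : Type u} {L : Type v} [Field k] [Ring L] [Bialgebra k L]

/-- The convolution ring structure `(p * q)(x) = p(x₁) q(x₂)`, with unit the counit of `L`. -/
instance : Ring (HopfDual k L) := inferInstanceAs (Ring (WithConv (L →ₗ[k] k)))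

instance : Algebra k (HopfDual k L) := inferInstanceAs (Algebra k (WithConv (L →ₗ[k] k)))

/-- `L^*` as the space of linear forms on `L`. -/
def HopfDual.equiv (k : Type u) (L : Type v) [Field k] [Ring L] [Bialgebra k L] :
    HopfDual k L ≃ₗ[k] Module.Dual k L :=
  WithConv.linearEquiv k (L →ₗ[k] k)

instance : FunLike (HopfDual k L) L k where
  coe p := HopfDual.equiv k L p
  coe_injective _ _ h := (HopfDual.equiv k L).injective (DFunLike.coe_injective h)

instance : LinearMapClass (HopfDual k L) k L k where
  map_add p := map_add (HopfDual.equiv k L p)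
  map_smulₛₗ p := map_smul (HopfDual.equiv k L p)

@[ext] theorem HopfDual.ext {p q : HopfDual k L} (h : ∀ x, p x = q x) : p = q :=
  DFunLike.ext p q h

@[simp] theorem HopfDual.equiv_apply (p : HopfDual k L) (x : L) :
    HopfDual.equiv k L p x = p x := rfl

@[simp] theorem HopfDual.equiv_symm_apply (p : Module.Dual k L) (x : L) :
    (HopfDual.equiv k L).symm p x = p x := rfl

@[simp] theorem HopfDual.add_apply (p q : HopfDual k L) (x : L) : (p + q) x = p x + q x := rfl

@[simp] theorem HopfDual.zero_apply (x : L) : (0 : HopfDual k L) x = 0 := rfl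

@[simp] theorem HopfDual.smul_apply (c : k) (p : HopfDual k L) (x : L) :
    (c • p) x = c * p x := rfl

@[simp] theorem HopfDual.sum_apply {ι : Type*} (s : Finset ι) (f : ι → HopfDual k L) (x : L) :
    (∑ i ∈ s, f i) x = ∑ i ∈ s, f i x := by
  rw [← HopfDual.equiv_apply, map_sum, LinearMap.sum_apply]; rfl

@[simp] theorem HopfDual.one_apply (x : L) : (1 : HopfDual k L) x = counit (R := k) x := rfl

theorem HopfDual.mul_apply (p q : HopfDual k L) (x : L) :
    (p * q) x = LinearMap.mul' k k (TensorProduct.map (HopfDual.equiv k L p)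
      (HopfDual.equiv k L q) (comul x)) := rfl

theorem HopfDual.mul_apply_repr {ι : Type*} (p q : HopfDual k L) {x : L}
    (r : Coalgebra.Repr k x ι) :
    (p * q) x = ∑ i ∈ r.index, p (r.left i) * q (r.right i) := by
  rw [HopfDual.mul_apply, ← r.eq]
  simp

theorem HopfDual.mul_apply_mul (p q : HopfDual k L) (x y : L) :
    (p * q) (x * y) = ∑ i ∈ (ℛ k x).index, ∑ j ∈ (ℛ k y).index,
      p ((ℛ k x).left i * (ℛ k y).left j) * q ((ℛ k x).right i * (ℛ k y).right j) := by
  rw [HopfDual.mul_apply, Bialgebra.comul_mul]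
  conv_lhs => rw [← (ℛ k x).eq, ← (ℛ k y).eq]
  simp [Finset.sum_mul_sum]

/-- The evaluation of a linear form at `x`. -/
def dualEval (x : L) : HopfDual k L →ₗ[k] k :=
  LinearMap.applyₗ x ∘ₗ (HopfDual.equiv k L).toLinearMap

@[simp] theorem dualEval_apply (x : L) (p : HopfDual k L) : dualEval x p = p x := rfl

/-- The pairing of `L^* ⊗ L^*` with `L × L`: `⟨p ⊗ q, (x, y)⟩ = p x * q y`. -/
def dualPairing (x y : L) : HopfDual k L ⊗[k] HopfDual k L →ₗ[k] k :=
  LinearMap.mul' k k ∘ₗ TensorProduct.map (dualEval x) (dualEval y)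

@[simp] theorem dualPairing_tmul (x y : L) (p q : HopfDual k L) :
    dualPairing x y (p ⊗ₜ q) = p x * q y := rfl

/-- Contraction of the first tensor factor with `x`. -/
def dualSlice {M : Type*} [AddCommGroup M] [Module k M] (x : L) :
    HopfDual k L ⊗[k] M →ₗ[k] M :=
  TensorProduct.lid k M ∘ₗ (dualEval x).rTensor M

@[simp] theorem dualSlice_tmul {M : Type*} [AddCommGroup M] [Module k M] (x : L)
    (p : HopfDual k L) (m : M) : dualSlice x (p ⊗ₜ[k] m) = p x • m := rfl

theorem dualPairing_eq_slice (x y : L) (t : HopfDual k L ⊗[k] HopfDual k L) :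
    dualPairing x y t = dualSlice x t y := by
  induction t using TensorProduct.induction_on with
  | zero => simp
  | tmul p q => simp
  | add a b ha hb => simp [ha, hb]

theorem dualPairing_mul (x y : L) (s t : HopfDual k L ⊗[k] HopfDual k L) :
    dualPairing x y (s * t) = ∑ i ∈ (ℛ k x).index, ∑ j ∈ (ℛ k y).index,
      dualPairing ((ℛ k x).left i) ((ℛ k y).left j) s *
        dualPairing ((ℛ k x).right i) ((ℛ k y).right j) t := by
  induction s using TensorProduct.induction_on with
  | zero => simp
  | add a b ha hb => simp [add_mul, ha, hb, Finset.sum_add_distrib]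
  | tmul a b =>
    induction t using TensorProduct.induction_on with
    | zero => simp
    | add a b ha hb => simp only [mul_add, ha, hb, Finset.sum_add_distrib, map_add]
    | tmul c d =>
      simp only [Algebra.TensorProduct.tmul_mul_tmul, dualPairing_tmul,
        HopfDual.mul_apply_repr _ _ (ℛ k x), HopfDual.mul_apply_repr _ _ (ℛ k y),
        Finset.sum_mul_sum]
      exact Finset.sum_congr rfl fun _ _ => Finset.sum_congr rfl fun _ _ => by ring

variable [FiniteDimensional k L]

theorem dualSlice_ext {M : Type*} [AddCommGroup M]
    [Module k M] {s t : HopfDual k L ⊗[k] M}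
    (h : ∀ x : L, dualSlice x s = dualSlice x t) : s = t := by
  have key : ∀ (x : L) (s : HopfDual k L ⊗[k] M), dualSlice x s =
      dualTensorHomEquiv k L M
        (TensorProduct.congr (HopfDual.equiv k L) (.refl k M) s) x := by
    intro x s
    induction s using TensorProduct.induction_on with
    | zero => simp
    | tmul p q => simp
    | add a b ha hb => simp only [map_add, ha, hb, LinearMap.add_apply]
  apply (TensorProduct.congr (HopfDual.equiv k L) (.refl k M)).injective
  apply (dualTensorHomEquiv k L M).injective
  ext x
  simpa only [key] using h x

theorem dualPairing_ext {s t : HopfDual k L ⊗[k] HopfDual k L}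
    (h : ∀ x y, dualPairing x y s = dualPairing x y t) : s = t :=
  dualSlice_ext fun x => HopfDual.ext fun y => by simpa only [dualPairing_eq_slice] using h x y

/-- The comultiplication of `L^*`: the transpose `L^* → (L ⊗ L)^* ≅ L^* ⊗ L^*` of the
multiplication of `L`. -/
def dualComul : HopfDual k L →ₗ[k] HopfDual k L ⊗[k] HopfDual k L :=
  (TensorProduct.congr (HopfDual.equiv k L) (HopfDual.equiv k L)).symm.toLinearMap ∘ₗ
    (TensorProduct.dualDistribEquiv k L L).symm.toLinearMap ∘ₗ
    (LinearMap.mul' k L).dualMap ∘ₗ (HopfDual.equiv k L).toLinearMap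

/-- `Δ(p)` is characterised by `⟨Δ(p), x ⊗ y⟩ = ⟨p, x y⟩`. -/
@[simp] theorem dualPairing_dualComul (x y : L) (p : HopfDual k L) :
    dualPairing x y (dualComul p) = p (x * y) := by
  have h : ∀ t : HopfDual k L ⊗[k] HopfDual k L,
      dualPairing x y t = TensorProduct.dualDistribEquiv k L L
        (TensorProduct.congr (HopfDual.equiv k L) (HopfDual.equiv k L) t) (x ⊗ₜ y) := by
    intro t
    induction t using TensorProduct.induction_on with
    | zero => simp
    | tmul p q => rfl
    | add a b ha hb => simp [ha, hb]
  rw [h]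
  simp only [dualComul, LinearMap.comp_apply, LinearEquiv.coe_coe, LinearEquiv.apply_symm_apply]
  simp

theorem dualSlice_dualComul (x y : L) (p : HopfDual k L) :
    dualSlice x (dualComul p) y = p (x * y) := by
  rw [← dualPairing_eq_slice, dualPairing_dualComul]

instance : CoalgebraStruct k (HopfDual k L) where
  comul := dualComul
  counit := dualEval 1

theorem HopfDual.comul_apply (p : HopfDual k L) : comul (R := k) p = dualComul p := rfl

@[simp] theorem HopfDual.counit_apply (p : HopfDual k L) : counit (R := k) p = p 1 := rfl

instance : Coalgebra k (HopfDual k L) where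
  coassoc := by
    have h1 : ∀ (x y : L) (t : HopfDual k L ⊗[k] HopfDual k L),
        dualSlice y (dualSlice x (TensorProduct.assoc k (HopfDual k L) (HopfDual k L)
          (HopfDual k L) (comul.rTensor _ t))) = dualSlice (x * y) t := by
      intro x y t
      induction t using TensorProduct.induction_on with
      | zero => simp
      | tmul p q =>
        rw [LinearMap.rTensor_tmul, HopfDual.comul_apply, dualSlice_tmul, ← dualPairing_dualComul]
        induction dualComul p using TensorProduct.induction_on with
        | zero => simp
        | tmul a b => simp [mul_smul]
        | add a b ha hb => simp only [TensorProduct.add_tmul, map_add, ha, hb, add_smul]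
      | add a b ha hb => simp only [map_add, ha, hb]
    have h2 : ∀ (x : L) (t : HopfDual k L ⊗[k] HopfDual k L),
        dualSlice x (comul.lTensor (HopfDual k L) t) = comul (R := k) (dualSlice x t) := by
      intro x t
      induction t using TensorProduct.induction_on with
      | zero => simp
      | tmul p q => simp
      | add a b ha hb => simp only [map_add, ha, hb]
    refine LinearMap.ext fun p => dualSlice_ext fun x => dualSlice_ext fun y =>
      HopfDual.ext fun z => ?_
    simp only [LinearMap.comp_apply, LinearEquiv.coe_coe]
    rw [h1, h2]
    simp only [HopfDual.comul_apply]
    rw [dualSlice_dualComul, dualSlice_dualComul, dualSlice_dualComul, mul_assoc]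
  rTensor_counit_comp_comul := by
    have h1 : ∀ t : HopfDual k L ⊗[k] HopfDual k L,
        TensorProduct.lid k _ (counit.rTensor (HopfDual k L) t) = dualSlice 1 t := fun _ => rfl
    refine LinearMap.ext fun p => (TensorProduct.lid k _).injective (HopfDual.ext fun y => ?_)
    simp only [LinearMap.comp_apply]
    rw [h1, HopfDual.comul_apply, dualSlice_dualComul]
    simp
  lTensor_counit_comp_comul := by
    have h1 : ∀ (y : L) (t : HopfDual k L ⊗[k] HopfDual k L),
        TensorProduct.rid k _ (counit.lTensor (HopfDual k L) t) y = dualPairing y 1 t := by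
      intro y t
      induction t using TensorProduct.induction_on with
      | zero => simp
      | tmul p q => simp [mul_comm]
      | add a b ha hb => simp only [map_add, ← ha, ← hb, HopfDual.add_apply]
    refine LinearMap.ext fun p => (TensorProduct.rid k _).injective (HopfDual.ext fun y => ?_)
    simp only [LinearMap.comp_apply]
    rw [h1, HopfDual.comul_apply, dualPairing_dualComul]
    simp

instance : Bialgebra k (HopfDual k L) :=
  Bialgebra.mk' k (HopfDual k L) (by simp)
    (by
      intro p q
      simp [HopfDual.mul_apply, Algebra.TensorProduct.one_def])
    (by
      refine dualPairing_ext fun x y => ?_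
      rw [HopfDual.comul_apply, dualPairing_dualComul]
      simp [Algebra.TensorProduct.one_def])
    (by
      intro p q
      refine dualPairing_ext fun x y => ?_
      rw [dualPairing_mul]
      simp only [HopfDual.comul_apply, dualPairing_dualComul, HopfDual.mul_apply_mul])

end Dual

section DualHopf

open Coalgebra

variable {k : Type u} {L : Type v} [Field k] [Ring L] [HopfAlgebra k L]

/-- The antipode of `L^*`: the transpose of the antipode of `L`. -/
def dualAntipode : HopfDual k L →ₗ[k] HopfDual k L :=
  (HopfDual.equiv k L).symm.toLinearMap ∘ₗ (HopfAlgebra.antipode k (A := L)).dualMap ∘ₗ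
    (HopfDual.equiv k L).toLinearMap

@[simp] theorem dualAntipode_apply (p : HopfDual k L) (x : L) :
    dualAntipode p x = p (HopfAlgebra.antipode k x) := rfl

instance [FiniteDimensional k L] : HopfAlgebra k (HopfDual k L) where
  antipode := dualAntipode
  mul_antipode_rTensor_comul := by
    have h : ∀ (x : L) (t : HopfDual k L ⊗[k] HopfDual k L),
        LinearMap.mul' k (HopfDual k L) (dualAntipode.rTensor (HopfDual k L) t) x =
          ∑ i ∈ (ℛ k x).index, dualPairing (HopfAlgebra.antipode k ((ℛ k x).left i))
            ((ℛ k x).right i) t := by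
      intro x t
      induction t using TensorProduct.induction_on with
      | zero => simp
      | tmul p q => simp [HopfDual.mul_apply_repr _ _ (ℛ k x)]
      | add a b ha hb => simp only [map_add, HopfDual.add_apply, ha, hb, Finset.sum_add_distrib]
    refine LinearMap.ext fun p => HopfDual.ext fun x => ?_
    simp only [LinearMap.comp_apply]
    rw [h]
    simp only [HopfDual.comul_apply, dualPairing_dualComul]
    rw [← map_sum, HopfAlgebra.sum_antipode_mul_eq_smul]
    simp [Algebra.algebraMap_eq_smul_one, mul_comm]
  mul_antipode_lTensor_comul := by
    have h : ∀ (x : L) (t : HopfDual k L ⊗[k] HopfDual k L),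
        LinearMap.mul' k (HopfDual k L) (dualAntipode.lTensor (HopfDual k L) t) x =
          ∑ i ∈ (ℛ k x).index, dualPairing ((ℛ k x).left i)
            (HopfAlgebra.antipode k ((ℛ k x).right i)) t := by
      intro x t
      induction t using TensorProduct.induction_on with
      | zero => simp
      | tmul p q => simp [HopfDual.mul_apply_repr _ _ (ℛ k x)]
      | add a b ha hb => simp only [map_add, HopfDual.add_apply, ha, hb, Finset.sum_add_distrib]
    refine LinearMap.ext fun p => HopfDual.ext fun x => ?_
    simp only [LinearMap.comp_apply]
    rw [h]
    simp only [HopfDual.comul_apply, dualPairing_dualComul]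
    rw [← map_sum, HopfAlgebra.sum_mul_antipode_eq_smul]
    simp [Algebra.algebraMap_eq_smul_one, mul_comm]

end DualHopf

/-! ### The Heisenberg double -/

section Heisenberg

open Coalgebra

/-- The underlying vector space `L ⊗ L^*` of the Heisenberg double `H(L) = L # L^*`. -/
def Heisenberg (k : Type u) (L : Type v) [Field k] [Ring L] [Bialgebra k L] : Type (max u v) :=
  L ⊗[k] HopfDual k L

namespace Heisenberg

variable {k : Type u} {L : Type v} [Field k] [Ring L] [Bialgebra k L]

instance : AddCommGroup (Heisenberg k L) := inferInstanceAs (AddCommGroup (L ⊗[k] HopfDual k L))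

instance : Module k (Heisenberg k L) := inferInstanceAs (Module k (L ⊗[k] HopfDual k L))

/-- The identification of `H(L)` with `L ⊗ L^*` as a vector space. -/
def equiv (k : Type u) (L : Type v) [Field k] [Ring L] [Bialgebra k L] :
    L ⊗[k] HopfDual k L ≃ₗ[k] Heisenberg k L := LinearEquiv.refl k _

/-- The element `h # p` of `H(L)`. -/
def smash (h : L) (p : HopfDual k L) : Heisenberg k L := equiv k L (h ⊗ₜ p)

/-- The left action of `L` on `L^*`: `⟨h · p, x⟩ = ⟨p, x h⟩`. -/
def act : L →ₗ[k] HopfDual k L →ₗ[k] HopfDual k L :=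
  LinearMap.mk₂ k (fun h p => (HopfDual.equiv k L).symm
      (HopfDual.equiv k L p ∘ₗ LinearMap.mulRight k h))
    (fun _ _ _ => HopfDual.ext fun _ => by simp [mul_add])
    (fun _ _ _ => HopfDual.ext fun _ => by simp)
    (fun _ _ _ => HopfDual.ext fun _ => by simp)
    (fun _ _ _ => HopfDual.ext fun _ => by simp)

@[simp] theorem act_apply (h : L) (p : HopfDual k L) (x : L) : act h p x = p (x * h) := rfl

theorem act_act (h g : L) (p : HopfDual k L) : act h (act g p) = act (h * g) p :=
  HopfDual.ext fun x => by simp [mul_assoc]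

theorem act_one (h : L) : act h (1 : HopfDual k L) = counit (R := k) h • 1 :=
  HopfDual.ext fun x => by simp [mul_comm]

@[simp] theorem one_act (p : HopfDual k L) : act 1 p = p :=
  HopfDual.ext fun x => by simp

theorem act_mul (h : L) (p q : HopfDual k L) :
    act h (p * q) = ∑ i ∈ (ℛ k h).index, act ((ℛ k h).left i) p * act ((ℛ k h).right i) q := by
  ext x
  rw [act_apply, HopfDual.mul_apply_mul, HopfDual.sum_apply, Finset.sum_comm]
  exact Finset.sum_congr rfl fun i _ => by simp [HopfDual.mul_apply_repr _ _ (ℛ k x)]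

/-- The map `x ⊗ y ↦ y g # p (x · q)`. -/
def smashAux (p : HopfDual k L) (g : L) (q : HopfDual k L) : L ⊗[k] L →ₗ[k] Heisenberg k L :=
  (equiv k L).toLinearMap ∘ₗ
    TensorProduct.map (LinearMap.mulRight k g) (LinearMap.mulLeft k p ∘ₗ act.flip q) ∘ₗ
    (TensorProduct.comm k L L).toLinearMap

@[simp] theorem smashAux_tmul (p : HopfDual k L) (g : L) (q : HopfDual k L) (x y : L) :
    smashAux p g q (x ⊗ₜ y) = smash (y * g) (p * act x q) := rfl

theorem smash_add_left (h g : L) (p : HopfDual k L) :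
    smash (h + g) p = smash h p + smash g p := by
  simp [smash, TensorProduct.add_tmul]

theorem smash_add_right (h : L) (p q : HopfDual k L) :
    smash h (p + q) = smash h p + smash h q := by
  simp [smash, TensorProduct.tmul_add]

theorem smash_smul_left (c : k) (h : L) (p : HopfDual k L) :
    smash (c • h) p = c • smash h p := by
  simp [smash, ← TensorProduct.smul_tmul']

theorem smash_smul_right (c : k) (h : L) (p : HopfDual k L) :
    smash h (c • p) = c • smash h p := by
  simp [smash]

theorem smash_sum_left {ι : Type*} (s : Finset ι) (f : ι → L) (p : HopfDual k L) :
    smash (∑ i ∈ s, f i) p = ∑ i ∈ s, smash (f i) p := by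
  simp [smash, TensorProduct.sum_tmul]

theorem smash_sum_right {ι : Type*} (s : Finset ι) (h : L) (f : ι → HopfDual k L) :
    smash h (∑ i ∈ s, f i) = ∑ i ∈ s, smash h (f i) := by
  simp [smash, TensorProduct.tmul_sum]

theorem smash_induction {motive : Heisenberg k L → Prop} (x : Heisenberg k L)
    (zero : motive 0) (smash : ∀ h p, motive (smash h p))
    (add : ∀ x y, motive x → motive y → motive (x + y)) : motive x :=
  TensorProduct.induction_on (motive := fun t => motive (equiv k L t)) x zero smash
    (fun _ _ => add _ _)

theorem smashAux_congr {p p₁ p₂ : HopfDual k L} {g g₁ g₂ : L} {q q₁ q₂ : HopfDual k L} (c₁ c₂ : k)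
    (h : ∀ x y : L, smashAux p g q (x ⊗ₜ y) =
      c₁ • smashAux p₁ g₁ q₁ (x ⊗ₜ y) + c₂ • smashAux p₂ g₂ q₂ (x ⊗ₜ y)) :
    smashAux p g q = c₁ • smashAux p₁ g₁ q₁ + c₂ • smashAux p₂ g₂ q₂ :=
  TensorProduct.ext' h

/-- The bilinear map `(h # p, g # q) ↦ h₂ g # p (h₁ · q)`. -/
def mulAux₀ : L ⊗[k] HopfDual k L →ₗ[k] L ⊗[k] HopfDual k L →ₗ[k] Heisenberg k L :=
  TensorProduct.lift (LinearMap.mk₂ k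
    (fun h p => TensorProduct.lift (LinearMap.mk₂ k (fun g q => smashAux p g q (comul h))
      (fun g₁ g₂ q => by
        rw [smashAux_congr (p₁ := p) (p₂ := p) (q₁ := q) (q₂ := q) (g₁ := g₁) (g₂ := g₂) 1 1
          fun x y => by simp [mul_add, smash_add_left]]
        simp)
      (fun c g q => by
        rw [smashAux_congr (p₁ := p) (p₂ := p) (q₁ := q) (q₂ := q) (g₁ := g) (g₂ := g) c 0
          fun x y => by simp [smash_smul_left]]
        simp)
      (fun g q₁ q₂ => by
        rw [smashAux_congr (p₁ := p) (p₂ := p) (q₁ := q₁) (q₂ := q₂) (g₁ := g) (g₂ := g) 1 1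
          fun x y => by simp [mul_add, smash_add_right]]
        simp)
      (fun c g q => by
        rw [smashAux_congr (p₁ := p) (p₂ := p) (q₁ := q) (q₂ := q) (g₁ := g) (g₂ := g) c 0
          fun x y => by simp [smash_smul_right]]
        simp)))
    (fun h₁ h₂ p => TensorProduct.ext' fun g q => by simp)
    (fun c h p => TensorProduct.ext' fun g q => by simp)
    (fun h p₁ p₂ => TensorProduct.ext' fun g q => by
      simp only [TensorProduct.lift.tmul, LinearMap.mk₂_apply, LinearMap.add_apply]
      rw [smashAux_congr (p₁ := p₁) (p₂ := p₂) (q₁ := q) (q₂ := q) (g₁ := g) (g₂ := g) 1 1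
          fun x y => by simp [add_mul, smash_add_right]]
      simp)
    (fun c h p => TensorProduct.ext' fun g q => by
      simp only [TensorProduct.lift.tmul, LinearMap.mk₂_apply, LinearMap.smul_apply]
      rw [smashAux_congr (p₁ := p) (p₂ := p) (q₁ := q) (q₂ := q) (g₁ := g) (g₂ := g) c 0
          fun x y => by simp [smash_smul_right]]
      simp))

/-- The multiplication of `H(L)` as a bilinear map. -/
def mulAux : Heisenberg k L →ₗ[k] Heisenberg k L →ₗ[k] Heisenberg k L := mulAux₀

instance : Mul (Heisenberg k L) := ⟨fun x y => mulAux x y⟩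

instance : One (Heisenberg k L) := ⟨smash 1 1⟩

theorem one_def : (1 : Heisenberg k L) = smash 1 1 := rfl

/-- The multiplication rule `(h # p)(g # q) = h₂ g # p (h₁ · q)`. -/
theorem smash_mul_smash (h g : L) (p q : HopfDual k L) :
    smash h p * smash g q = smashAux p g q (comul h) := rfl

theorem smash_mul_smash_repr {ι : Type*} {h : L} (r : Coalgebra.Repr k h ι) (g : L)
    (p q : HopfDual k L) :
    smash h p * smash g q =
      ∑ i ∈ r.index, smash (r.right i * g) (p * act (r.left i) q) := by
  rw [smash_mul_smash, ← r.eq, map_sum]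
  rfl

theorem left_distrib_aux (x y z : Heisenberg k L) : x * (y + z) = x * y + x * z :=
  map_add (mulAux x) y z

theorem right_distrib_aux (x y z : Heisenberg k L) : (x + y) * z = x * z + y * z :=
  LinearMap.map_add₂ mulAux x y z

theorem zero_mul_aux (x : Heisenberg k L) : 0 * x = 0 :=
  LinearMap.map_zero₂ mulAux x

theorem mul_zero_aux (x : Heisenberg k L) : x * 0 = 0 :=
  map_zero (mulAux x)

theorem sum_mul_aux {ι : Type*} (s : Finset ι) (f : ι → Heisenberg k L)
    (x : Heisenberg k L) : (∑ i ∈ s, f i) * x = ∑ i ∈ s, f i * x :=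
  LinearMap.map_sum₂ mulAux s f x

theorem mul_sum_aux {ι : Type*} (s : Finset ι) (f : ι → Heisenberg k L)
    (x : Heisenberg k L) : x * (∑ i ∈ s, f i) = ∑ i ∈ s, x * f i :=
  map_sum (mulAux x) f s

theorem mul_assoc_aux (x y z : Heisenberg k L) : x * y * z = x * (y * z) := by
  induction x using smash_induction with
  | zero => simp only [zero_mul_aux]
  | add a b ha hb => simp only [right_distrib_aux, ha, hb]
  | smash h p =>
  induction y using smash_induction with
  | zero => simp only [zero_mul_aux, mul_zero_aux]
  | add a b ha hb => simp only [right_distrib_aux, left_distrib_aux, ha, hb]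
  | smash g q =>
  induction z using smash_induction with
  | zero => simp only [mul_zero_aux]
  | add a b ha hb => simp only [left_distrib_aux, ha, hb]
  | smash f r =>
  rw [smash_mul_smash_repr (ℛ k h), smash_mul_smash_repr (ℛ k g), sum_mul_aux, mul_sum_aux]
  have hl : ∀ i ∈ (ℛ k h).index,
      smash ((ℛ k h).right i * g) (p * act ((ℛ k h).left i) q) * smash f r =
      ∑ l ∈ (ℛ k g).index, ∑ j ∈ (ℛ k ((ℛ k h).right i)).index,
        smash ((ℛ k ((ℛ k h).right i)).right j * ((ℛ k g).right l * f))
          (p * (act ((ℛ k h).left i) q *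
            act ((ℛ k ((ℛ k h).right i)).left j) (act ((ℛ k g).left l) r))) := by
    intro i _
    rw [smash_mul_smash, Bialgebra.comul_mul]
    conv_lhs => rw [← (ℛ k ((ℛ k h).right i)).eq, ← (ℛ k g).eq]
    rw [Finset.sum_mul_sum, Finset.sum_comm]
    simp only [map_sum, Algebra.TensorProduct.tmul_mul_tmul, smashAux_tmul, act_act, mul_assoc]
  have hr : ∀ l ∈ (ℛ k g).index,
      smash h p * smash ((ℛ k g).right l * f) (q * act ((ℛ k g).left l) r) =
      ∑ i ∈ (ℛ k h).index, ∑ j ∈ (ℛ k ((ℛ k h).left i)).index,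
        smash ((ℛ k h).right i * ((ℛ k g).right l * f))
          (p * (act ((ℛ k ((ℛ k h).left i)).left j) q *
            act ((ℛ k ((ℛ k h).left i)).right j) (act ((ℛ k g).left l) r))) := by
    intro l _
    rw [smash_mul_smash_repr (ℛ k h)]
    refine Finset.sum_congr rfl fun i _ => ?_
    rw [act_mul, Finset.mul_sum, smash_sum_right]
  rw [Finset.sum_congr rfl hl, Finset.sum_congr rfl hr, Finset.sum_comm]
  refine Finset.sum_congr rfl fun l _ => ?_
  have key := sum_tmul_tmul_eq (ℛ k h) (fun i => ℛ k ((ℛ k h).left i))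
    (fun i => ℛ k ((ℛ k h).right i))
  have := congrArg ((equiv k L).toLinearMap ∘ₗ TensorProduct.map
      (LinearMap.mulRight k ((ℛ k g).right l * f))
      (LinearMap.mulLeft k p ∘ₗ LinearMap.mul' k (HopfDual k L) ∘ₗ
        TensorProduct.map (act.flip q) (act.flip (act ((ℛ k g).left l) r))) ∘ₗ
      (TensorProduct.comm k _ _).toLinearMap ∘ₗ
      (TensorProduct.assoc k L L L).symm.toLinearMap) key
  simp only [map_sum] at this
  exact this.symm

instance : Ring (Heisenberg k L) where
  __ := (inferInstance : AddCommGroup (Heisenberg k L))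
  left_distrib := left_distrib_aux
  right_distrib := right_distrib_aux
  zero_mul := zero_mul_aux
  mul_zero := mul_zero_aux
  mul_assoc := mul_assoc_aux
  one_mul x := by
    induction x using smash_induction with
    | zero => exact mul_zero_aux _
    | add a b ha hb => rw [left_distrib_aux, ha, hb]
    | smash h p =>
      rw [one_def, smash_mul_smash, Bialgebra.comul_one, Algebra.TensorProduct.one_def]
      simp
  mul_one x := by
    induction x using smash_induction with
    | zero => exact zero_mul_aux _
    | add a b ha hb => rw [right_distrib_aux, ha, hb]
    | smash h p =>
      rw [one_def, smash_mul_smash_repr (ℛ k h)]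
      simp only [mul_one, act_one, mul_smul_comm, smash_smul_right, ← smash_smul_left]
      rw [← smash_sum_left, sum_counit_smul]

instance : Algebra k (Heisenberg k L) :=
  Algebra.ofModule (fun c x y => LinearMap.map_smul₂ mulAux c x y)
    (fun c x y => map_smul (mulAux x) c y)

/-- The canonical element `∑ᵢ (eᵢ # ε) ⊗ (1 # eᵢ*)` of `H(L) ⊗ H(L)`. -/
def canonical (k : Type u) (L : Type v) [Field k] [Ring L] [Bialgebra k L]
    [FiniteDimensional k L] : Heisenberg k L ⊗[k] Heisenberg k L :=
  TensorProduct.map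
    ((equiv k L).toLinearMap ∘ₗ (TensorProduct.mk k L (HopfDual k L)).flip 1)
    ((equiv k L).toLinearMap ∘ₗ TensorProduct.mk k L (HopfDual k L) 1 ∘ₗ
      (HopfDual.equiv k L).symm.toLinearMap)
    (coevaluation k L 1)

end Heisenberg

end Heisenberg

/-! ### Hopf algebra structures on a given algebra -/

/-- The data turning a given `k`-algebra `B` into a Hopf algebra over `k`. -/
structure HopfStructure (k : Type u) (B : Type v) [Field k] [Ring B] [Algebra k B] where
  /-- The comultiplication. -/
  comul : B →ₐ[k] B ⊗[k] B
  /-- The counit. -/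
  counit : B →ₐ[k] k
  /-- The antipode. -/
  antipode : B →ₗ[k] B
  coassoc : (Algebra.TensorProduct.assoc k k k B B B).toAlgHom.comp
      ((Algebra.TensorProduct.map comul (.id k B)).comp comul) =
    (Algebra.TensorProduct.map (.id k B) comul).comp comul
  rTensor_counit : (Algebra.TensorProduct.map counit (.id k B)).comp comul =
    (Algebra.TensorProduct.lid k B).symm
  lTensor_counit : (Algebra.TensorProduct.map (.id k B) counit).comp comul =
    (Algebra.TensorProduct.rid k k B).symm
  mul_antipode_rTensor_comul :
    LinearMap.mul' k B ∘ₗ antipode.rTensor B ∘ₗ comul.toLinearMap =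
      Algebra.linearMap k B ∘ₗ counit.toLinearMap
  mul_antipode_lTensor_comul :
    LinearMap.mul' k B ∘ₗ antipode.lTensor B ∘ₗ comul.toLinearMap =
      Algebra.linearMap k B ∘ₗ counit.toLinearMap

/-- `B`, with its given algebra structure, as a Hopf algebra. -/
abbrev HopfStructure.toHopfAlgebra {k : Type u} {B : Type v} [Field k] [Ring B] [Algebra k B]
    (s : HopfStructure k B) : HopfAlgebra k B where
  toBialgebra := Bialgebra.ofAlgHom s.comul s.counit s.coassoc s.rTensor_counit s.lTensor_counit
  antipode := s.antipode
  mul_antipode_rTensor_comul := s.mul_antipode_rTensor_comul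
  mul_antipode_lTensor_comul := s.mul_antipode_lTensor_comul

/-! ### The pentagon equation -/

section Pentagon

variable {k : Type u} {A : Type v} [Field k] [Ring A] [Algebra k A]

/-- `R^{12} ∈ A ⊗ A ⊗ A`: `a ⊗ b ↦ a ⊗ b ⊗ 1`. -/
def leg12 : A ⊗[k] A →ₐ[k] A ⊗[k] (A ⊗[k] A) :=
  Algebra.TensorProduct.map (AlgHom.id k A) Algebra.TensorProduct.includeLeft

/-- `R^{13} ∈ A ⊗ A ⊗ A`: `a ⊗ b ↦ a ⊗ 1 ⊗ b`. -/
def leg13 : A ⊗[k] A →ₐ[k] A ⊗[k] (A ⊗[k] A) :=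
  Algebra.TensorProduct.map (AlgHom.id k A) Algebra.TensorProduct.includeRight

/-- `R^{23} ∈ A ⊗ A ⊗ A`: `a ⊗ b ↦ 1 ⊗ a ⊗ b`. -/
def leg23 : A ⊗[k] A →ₐ[k] A ⊗[k] (A ⊗[k] A) :=
  Algebra.TensorProduct.includeRight

/-- The pentagon equation `R^{12} R^{13} R^{23} = R^{23} R^{12}`. -/
def IsPentagon (R : A ⊗[k] A) : Prop :=
  leg12 R * leg13 R * leg23 R = leg23 R * leg12 R

/-- For a linear form `φ` on `V`, the map `V ⊗ W → W`, `v ⊗ w ↦ ⟨φ, v⟩ w`. -/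
def contractFst {V W : Type*} [AddCommGroup V] [Module k V] [AddCommGroup W] [Module k W]
    (φ : Module.Dual k V) : V ⊗[k] W →ₗ[k] W :=
  (TensorProduct.lid k W).toLinearMap ∘ₗ φ.rTensor W

/-- For a linear form `φ` on `W`, the map `V ⊗ W → V`, `v ⊗ w ↦ ⟨φ, w⟩ v`. -/
def contractSnd {V W : Type*} [AddCommGroup V] [Module k V] [AddCommGroup W] [Module k W]
    (φ : Module.Dual k W) : V ⊗[k] W →ₗ[k] V :=
  (TensorProduct.rid k V).toLinearMap ∘ₗ φ.lTensor V

/-- The space `R_{(l)} = {∑ ⟨φ, R²⟩ R¹ | φ ∈ A^*}` of left coefficients of `R`. -/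
def leftCoeff (R : A ⊗[k] A) : Submodule k A where
  carrier := {x | ∃ φ : Module.Dual k A, contractSnd φ R = x}
  zero_mem' := ⟨0, by simp [contractSnd]⟩
  add_mem' := by
    rintro _ _ ⟨φ, rfl⟩ ⟨ψ, rfl⟩
    exact ⟨φ + ψ, by simp [contractSnd, LinearMap.lTensor_add]⟩
  smul_mem' := by
    rintro c _ ⟨φ, rfl⟩
    exact ⟨c • φ, by simp [contractSnd, LinearMap.lTensor_smul]⟩

/-- The space `R_{(r)} = {∑ ⟨φ, R¹⟩ R² | φ ∈ A^*}` of right coefficients of `R`. -/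
def rightCoeff (R : A ⊗[k] A) : Submodule k A where
  carrier := {y | ∃ φ : Module.Dual k A, contractFst φ R = y}
  zero_mem' := ⟨0, by simp [contractFst]⟩
  add_mem' := by
    rintro _ _ ⟨φ, rfl⟩ ⟨ψ, rfl⟩
    exact ⟨φ + ψ, by simp [contractFst, LinearMap.rTensor_add]⟩
  smul_mem' := by
    rintro c _ ⟨φ, rfl⟩
    exact ⟨c • φ, by simp [contractFst, LinearMap.rTensor_smul]⟩

/-- `R` is unitary if `1 ∈ R_{(l)} ∩ R_{(r)}`. -/
def IsUnitary (R : A ⊗[k] A) : Prop :=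
  (1 : A) ∈ leftCoeff R ∧ (1 : A) ∈ rightCoeff R

/-- The length `l(R)`: the least `m` such that `R` is a sum of `m` elementary tensors. -/
def tensorLength (R : A ⊗[k] A) : ℕ :=
  sInf {m : ℕ | ∃ a b : Fin m → A, R = ∑ i, a i ⊗ₜ[k] b i}

/-- The left `R`-coinvariants `A^{R,l} = {a | R (a ⊗ 1) = a ⊗ 1}`. -/
def leftCoinvariants (R : A ⊗[k] A) : Submodule k A where
  carrier := {a | R * (a ⊗ₜ[k] (1 : A)) = a ⊗ₜ[k] (1 : A)}
  zero_mem' := by simp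
  add_mem' := by
    intro a b (ha : _ = _) (hb : _ = _)
    simp [TensorProduct.add_tmul, mul_add, ha, hb]
  smul_mem' := by
    intro c a (ha : _ = _)
    simp [← TensorProduct.smul_tmul', ha]

/-- The right `R`-coinvariants `A^{R,r} = {a | (1 ⊗ a) R = 1 ⊗ a}`. -/
def rightCoinvariants (R : A ⊗[k] A) : Submodule k A where
  carrier := {a | ((1 : A) ⊗ₜ[k] a) * R = (1 : A) ⊗ₜ[k] a}
  zero_mem' := by simp
  add_mem' := by
    intro a b (ha : _ = _) (hb : _ = _)
    simp [TensorProduct.tmul_add, add_mul, ha, hb]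
  smul_mem' := by
    intro c a (ha : _ = _)
    simp [ha]

/-- `P`, with the Hopf algebra structure `hopf`, is the Hopf algebra `P(A, R)`: the subalgebra with
underlying space `R_{(l)}`, and the comultiplication `Δ(x) = R⁻¹ (1 ⊗ x) R`. -/
def IsLeftHopf (R : (A ⊗[k] A)ˣ) (P : Subalgebra k A) (hopf : HopfStructure k P) : Prop :=
  Subalgebra.toSubmodule P = leftCoeff (R : A ⊗[k] A) ∧
    ∀ x : P, Algebra.TensorProduct.map P.val P.val (hopf.comul x) =
      (↑R⁻¹ : A ⊗[k] A) * ((1 : A) ⊗ₜ[k] (x : A)) * (R : A ⊗[k] A)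

/-- `H`, with the Hopf algebra structure `hopf`, is the Hopf algebra `H(A, R)`: the subalgebra with
underlying space `R_{(r)}`, and the comultiplication `Δ(y) = R (y ⊗ 1) R⁻¹`. -/
def IsRightHopf (R : (A ⊗[k] A)ˣ) (H : Subalgebra k A) (hopf : HopfStructure k H) : Prop :=
  Subalgebra.toSubmodule H = rightCoeff (R : A ⊗[k] A) ∧
    ∀ y : H, Algebra.TensorProduct.map H.val H.val (hopf.comul y) =
      (R : A ⊗[k] A) * ((y : A) ⊗ₜ[k] (1 : A)) * (↑R⁻¹ : A ⊗[k] A)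

/-- The invertible element `(f ⊗ f)(R)`. -/
def mapUnit {B : Type*} [Ring B] [Algebra k B] (f : A →ₐ[k] B) (R : (A ⊗[k] A)ˣ) :
    (B ⊗[k] B)ˣ :=
  Units.map (Algebra.TensorProduct.map f f : A ⊗[k] A →* B ⊗[k] B) R

/-- The invertible element `u ⊗ u`. -/
def unitTensor (k : Type u) {A : Type v} [Field k] [Ring A] [Algebra k A] (u : Aˣ) :
    (A ⊗[k] A)ˣ where
  val := (u : A) ⊗ₜ[k] (u : A)
  inv := (↑u⁻¹ : A) ⊗ₜ[k] (↑u⁻¹ : A)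
  val_inv := by simp [Algebra.TensorProduct.one_def]
  inv_val := by simp [Algebra.TensorProduct.one_def]

end Pentagon

end PentagonEq

end

open PentagonEq

/-! Write `R = ∑ aᵢ ⊗ bᵢ`. Contracting a leg of the pentagon equation turns it into statements about
coefficients: `R⁻¹ (1 ⊗ x) R` and `R (y ⊗ 1) R⁻¹` are transposes of the multiplications of right and
left coefficients (`IsPentagon.conj_one_tmul`, `IsPentagon.conj_tmul_one`). Hence `P` and `H` are
closed under products, and `P^* → H` is bijective because `φ (right p) = p (left φ)`
(`apply_right`). Through this pairing coassociativity of `Δ_P` is associativity of `H`, the counit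
is the functional whose right coefficient is `1`, and the antipode comes from `R⁻¹`, which lies in
`P ⊗ H` because left multiplication by `R` on that finite dimensional space is injective, hence
surjective. The Hopf structure of `H` is transported from `P^*`.

Contracting the two outer legs of the pentagon gives the rule for moving `P` past `H`
(`IsPentagon.coeff_mul_coeff`). It is the multiplication rule of the Heisenberg double, so `F : H(P)
→ A` exists; its range contains `P` and `H`, which bounds `dim A_R` by `(dim P)²`.

The module statement rests on the fact that `H(L)` acts on `L^*` as the full endomorphism algebra
(`heisenbergAct_bijective`). The proof does not assume the antipode bijective; it uses simplicity of
`End(L^*)`. So `H(L)` contains the rank one operator `W : r ↦ r(1) ε`, and `∑ eᵢ^* W eᵢ = 1`. In any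
algebra receiving `H(L)`, multiplication by the image of `W` projects onto the coinvariants, and
this resolution of the identity yields the tensor decompositions. -/

noncomputable section

namespace PentagonEq

universe u v

/-! ### The Heisenberg double of a finite dimensional Hopf algebra is `End(L^*)`. -/

section LarsonSweedler

open Coalgebra WithConv HopfAlgebra Heisenberg

variable {k : Type u} {L : Type v} [Field k] [Ring L] [HopfAlgebra k L]

/-- In the convolution algebra of maps `L → L ⊗ L` one has `Δ = i₁ * i₂`, while `Δ ∘ S` is a left
inverse of `Δ` and `i₂ ∘ S` a right inverse of `i₂`. Cancelling gives `(Δ ∘ S) * i₁ = i₂ ∘ S`. -/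
theorem sum_comul_antipode_mul_tmul_one {ι : Type*} {g : L} (r : Coalgebra.Repr k g ι) :
    ∑ i ∈ r.index, comul (R := k) (antipode k (r.left i)) * (r.right i ⊗ₜ[k] (1 : L)) =
      (1 : L) ⊗ₜ[k] antipode k g := by
  let D : WithConv (L →ₗ[k] L ⊗[k] L) := toConv comul
  let DS : WithConv (L →ₗ[k] L ⊗[k] L) := toConv (comul ∘ₗ antipode k)
  let i₁ : WithConv (L →ₗ[k] L ⊗[k] L) :=
    toConv (Algebra.TensorProduct.includeLeft : L →ₐ[k] L ⊗[k] L).toLinearMap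
  let i₂ : WithConv (L →ₗ[k] L ⊗[k] L) :=
    toConv (Algebra.TensorProduct.includeRight : L →ₐ[k] L ⊗[k] L).toLinearMap
  let i₂S : WithConv (L →ₗ[k] L ⊗[k] L) :=
    toConv ((Algebra.TensorProduct.includeRight : L →ₐ[k] L ⊗[k] L).toLinearMap ∘ₗ antipode k)
  have h1 : D = i₁ * i₂ := by
    ext x
    rw [(ℛ k x).convMul_apply]
    conv_lhs => change comul x; rw [← (ℛ k x).eq]
    simp [i₁, i₂]
  have h2 : DS * D = 1 := by
    ext x
    rw [(ℛ k x).convMul_apply]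
    change ∑ i ∈ (ℛ k x).index, comul (R := k) (antipode k ((ℛ k x).left i)) *
      comul ((ℛ k x).right i) = algebraMap k _ (counit x)
    simp only [← Bialgebra.comul_mul, ← map_sum, sum_antipode_mul_eq_algebraMap_counit,
      Bialgebra.comul_algebraMap]
  have h3 : i₂ * i₂S = 1 := by
    ext x
    rw [(ℛ k x).convMul_apply]
    change ∑ i ∈ (ℛ k x).index, (1 : L) ⊗ₜ[k] (ℛ k x).left i *
      (1 : L) ⊗ₜ[k] antipode k ((ℛ k x).right i) = algebraMap k _ (counit x)
    simp only [Algebra.TensorProduct.tmul_mul_tmul, mul_one, ← TensorProduct.tmul_sum,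
      sum_mul_antipode_eq_algebraMap_counit, Algebra.algebraMap_eq_smul_one,
      TensorProduct.tmul_smul, Algebra.TensorProduct.one_def]
  have h4 : DS * i₁ = i₂S := by
    rw [← mul_one (DS * i₁), ← h3, ← mul_assoc, mul_assoc DS, ← h1, h2, one_mul]
  have h5 := congrArg (fun f : WithConv (L →ₗ[k] L ⊗[k] L) => f g) h4
  rw [r.convMul_apply] at h5
  exact h5

variable (k L) in
/-- `p ⊗ h ↦ (r ↦ (h · r) * p)`. -/
def rightSmashAct : HopfDual k L ⊗[k] L →ₗ[k] Module.End k (HopfDual k L) :=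
  TensorProduct.lift
    ((LinearMap.llcomp k (HopfDual k L) (HopfDual k L) (HopfDual k L) ∘ₗ
      (LinearMap.mul k (HopfDual k L)).flip).compl₂ act)

@[simp] theorem rightSmashAct_tmul_apply (p r : HopfDual k L) (h : L) :
    rightSmashAct k L (p ⊗ₜ h) r = act h r * p := rfl

variable (k L) in
/-- `p ⊗ h ↦ (r ↦ S(h) · (p * r))`. -/
def antipodeSmashAct : HopfDual k L ⊗[k] L →ₗ[k] Module.End k (HopfDual k L) :=
  TensorProduct.lift
    (((LinearMap.llcomp k (HopfDual k L) (HopfDual k L) (HopfDual k L)).flip ∘ₗ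
      (LinearMap.mul k (HopfDual k L))).compl₂ (act ∘ₗ antipode k))

@[simp] theorem antipodeSmashAct_tmul_apply (p r : HopfDual k L) (h : L) :
    antipodeSmashAct k L (p ⊗ₜ h) r = act (antipode k h) (p * r) := rfl

theorem act_mul_repr {ι : Type*} {h : L} (s : Coalgebra.Repr k h ι) (p q : HopfDual k L) :
    act h (p * q) = ∑ i ∈ s.index, act (s.left i) p * act (s.right i) q := by
  rw [act_mul]
  let Φ : L ⊗[k] L →ₗ[k] HopfDual k L :=
    LinearMap.mul' k _ ∘ₗ TensorProduct.map (act.flip p) (act.flip q)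
  have h1 : ∀ a b : L, act a p * act b q = Φ (a ⊗ₜ b) := fun a b => rfl
  simp only [h1, ← map_sum, Coalgebra.Repr.eq]

/-- Since `L` acts on products in `L^*` through `Δ`, this is the identity `∑ Δ(S(g₁)) (g₂ ⊗ 1) = 1 ⊗
S(g)` applied to `p ⊗ r`. -/
theorem mul_act_antipode {ι : Type*} {g : L} (s : Coalgebra.Repr k g ι) (p r : HopfDual k L) :
    p * act (antipode k g) r =
      ∑ i ∈ s.index, act (antipode k (s.left i)) (act (s.right i) p * r) := by
  let Φ : L ⊗[k] L →ₗ[k] HopfDual k L :=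
    LinearMap.mul' k _ ∘ₗ TensorProduct.map (act.flip p) (act.flip r)
  have h1 : ∀ a b : L, Φ (a ⊗ₜ b) = act a p * act b r := fun a b => rfl
  have h2 := congrArg Φ (sum_comul_antipode_mul_tmul_one s)
  rw [h1, one_act, map_sum] at h2
  rw [← h2]
  refine Finset.sum_congr rfl fun i _ => ?_
  rw [act_mul]
  conv_lhs => rw [← (ℛ k (antipode k (s.left i))).eq]
  simp [Finset.sum_mul, h1, act_act]

/-- The tensor on the right is the same as in `antipodeSmashAct_mul`, where the two factors are
composed in the opposite order. This comparison produces an anti-endomorphism of `End(L^*)`. -/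
theorem rightSmashAct_mul {ι : Type*} {g : L} (s : Coalgebra.Repr k g ι) (p q : HopfDual k L)
    (h : L) :
    rightSmashAct k L (q ⊗ₜ g) * rightSmashAct k L (p ⊗ₜ h) =
      rightSmashAct k L (∑ i ∈ s.index, (act (s.right i) p * q) ⊗ₜ (s.left i * h)) := by
  refine LinearMap.ext fun r => ?_
  simp only [Module.End.mul_apply, map_sum, LinearMap.sum_apply, rightSmashAct_tmul_apply,
    act_mul_repr s, Finset.sum_mul, act_act, mul_assoc]

theorem antipodeSmashAct_mul {ι : Type*} {g : L} (s : Coalgebra.Repr k g ι) (p q : HopfDual k L)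
    (h : L) :
    antipodeSmashAct k L (p ⊗ₜ h) * antipodeSmashAct k L (q ⊗ₜ g) =
      antipodeSmashAct k L (∑ i ∈ s.index, (act (s.right i) p * q) ⊗ₜ (s.left i * h)) := by
  refine LinearMap.ext fun r => ?_
  simp only [Module.End.mul_apply, map_sum, LinearMap.sum_apply, antipodeSmashAct_tmul_apply,
    mul_act_antipode s, act_act, antipode_mul_antidistrib, mul_assoc]

variable (k L) in
theorem nontrivial_hopfDual : Nontrivial (HopfDual k L) :=
  ⟨0, 1, fun h => by simpa using congrArg (fun p : HopfDual k L => p 1) h⟩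

theorem finrank_hopfDual : Module.finrank k (HopfDual k L) = Module.finrank k L := by
  rw [(HopfDual.equiv k L).finrank_eq, Subspace.dual_finrank_eq]

variable [FiniteDimensional k L]

instance : FiniteDimensional k (HopfDual k L) :=
  (HopfDual.equiv k L).symm.finiteDimensional

theorem rightSmashAct_bijective : Function.Bijective (rightSmashAct k L) := by
  have hinj : Function.Injective (rightSmashAct k L) := by
    rw [injective_iff_map_eq_zero]
    intro t ht
    -- View `t ∈ L^* ⊗ L` as a map `T : L → L`. Then the operator of `t` is the transpose of `id *
    -- T`, and `id` is convolution invertible with inverse the antipode, so `T` can be recovered.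
    let T : WithConv (L →ₗ[k] L) := toConv (dualTensorHom k L L
      (TensorProduct.map (HopfDual.equiv k L).toLinearMap LinearMap.id t))
    have hT : ∀ x, T x = dualSlice x t := by
      intro x
      change dualTensorHom k L L (TensorProduct.map _ _ t) x = _
      clear ht T
      induction t using TensorProduct.induction_on with
      | zero => simp
      | tmul p h => simp
      | add a b ha hb => simp only [map_add, LinearMap.add_apply, ha, hb]
    have h1 : ∀ (r : HopfDual k L) (x : L), r ((toConv LinearMap.id * T : WithConv (L →ₗ[k] L)) x) =
        rightSmashAct k L t r x := by
      intro r x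
      rw [(ℛ k x).convMul_apply]
      simp only [hT]
      clear hT T ht
      induction t using TensorProduct.induction_on with
      | zero => simp
      | tmul p h =>
        simp [HopfDual.mul_apply_repr _ _ (ℛ k x), mul_comm]
      | add a b ha hb =>
        simp only [map_add, mul_add, Finset.sum_add_distrib, LinearMap.add_apply, ha, hb,
          HopfDual.add_apply]
    have h2 : (toConv LinearMap.id * T : WithConv (L →ₗ[k] L)) = 0 := by
      ext x
      refine (Module.forall_dual_apply_eq_zero_iff k _).1 fun φ => ?_
      have := h1 ((HopfDual.equiv k L).symm φ) x
      rwa [ht, LinearMap.zero_apply, HopfDual.zero_apply] at this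
    have h3 : T = 0 := by
      rw [← one_mul T, ← LinearMap.antipode_mul_id, mul_assoc, h2, mul_zero]
    refine dualSlice_ext fun x => ?_
    rw [← hT, h3, map_zero]
    rfl
  have hdim : Module.finrank k (HopfDual k L ⊗[k] L) =
      Module.finrank k (Module.End k (HopfDual k L)) := by
    rw [Module.finrank_tensorProduct, Module.finrank_linearMap, finrank_hopfDual]
  exact ⟨hinj, (LinearMap.injective_iff_surjective_of_finrank_eq_finrank hdim).1 hinj⟩

/-- Composing with the inverse of `rightSmashAct` gives an anti-endomorphism `η` of `End(L^*)`. This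
ring is simple, so `η` is injective, hence bijective by finite dimension. Bijectivity of the
antipode is not assumed. -/
theorem antipodeSmashAct_bijective : Function.Bijective (antipodeSmashAct k L) := by
  let α : HopfDual k L ⊗[k] L ≃ₗ[k] Module.End k (HopfDual k L) :=
    LinearEquiv.ofBijective _ rightSmashAct_bijective
  let η : Module.End k (HopfDual k L) →ₗ[k] Module.End k (HopfDual k L) :=
    antipodeSmashAct k L ∘ₗ α.symm.toLinearMap
  have hη : ∀ t, η (rightSmashAct k L t) = antipodeSmashAct k L t := fun t =>
    congrArg (antipodeSmashAct k L) (α.symm_apply_apply t)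
  have hone : η 1 = 1 := by
    have h1 : rightSmashAct k L (1 ⊗ₜ 1) = 1 := LinearMap.ext fun r => by simp
    rw [← h1, hη]
    exact LinearMap.ext fun r => by simp
  have hmul : ∀ X Y, η (X * Y) = η Y * η X := by
    intro X Y
    obtain ⟨s, rfl⟩ := rightSmashAct_bijective.2 X
    obtain ⟨t, rfl⟩ := rightSmashAct_bijective.2 Y
    induction s using TensorProduct.induction_on with
    | zero => simp
    | add a b ha hb => simp only [map_add, add_mul, mul_add, ha, hb]
    | tmul q g =>
    induction t using TensorProduct.induction_on with
    | zero => simp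
    | add a b ha hb => simp only [map_add, add_mul, mul_add, ha, hb]
    | tmul p h => rw [rightSmashAct_mul (ℛ k g), hη, hη, hη, antipodeSmashAct_mul (ℛ k g)]
  -- Read as a ring homomorphism into the opposite ring, so that injectivity of homomorphisms out of
  -- a simple ring applies.
  let η' : Module.End k (HopfDual k L) →+* (Module.End k (HopfDual k L))ᵐᵒᵖ :=
    { toFun X := .op (η X)
      map_one' := by rw [hone]; rfl
      map_mul' X Y := by rw [hmul]; rfl
      map_zero' := by rw [map_zero]; rfl
      map_add' X Y := by rw [map_add]; rfl }
  have := nontrivial_hopfDual k L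
  have : Nonempty (Fin (Module.finrank k (HopfDual k L))) :=
    ⟨⟨0, Module.finrank_pos⟩⟩
  have : IsSimpleRing (Module.End k (HopfDual k L)) :=
    .of_ringEquiv (algEquivMatrix (Module.finBasis k (HopfDual k L))).symm.toRingEquiv inferInstance
  have hinj : Function.Injective η := fun X Y h => η'.injective (congrArg MulOpposite.op h)
  have hbij : Function.Bijective η := ⟨hinj, LinearMap.injective_iff_surjective.1 hinj⟩
  convert hbij.comp rightSmashAct_bijective using 1
  exact funext fun t => (hη t).symm

variable (k L) in
/-- The action of the Heisenberg double on `L^*` as a linear map. -/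
def heisenbergActAux : Heisenberg k L →ₗ[k] Module.End k (HopfDual k L) :=
  TensorProduct.lift ((LinearMap.llcomp k (HopfDual k L) (HopfDual k L) (HopfDual k L) ∘ₗ
    LinearMap.mul k (HopfDual k L)).flip.comp act) ∘ₗ (equiv k L).symm.toLinearMap

omit [FiniteDimensional k L] in
theorem heisenbergActAux_smash_apply (h : L) (p r : HopfDual k L) :
    heisenbergActAux k L (smash h p) r = p * act h r := rfl

variable (k L) in
/-- The action `(h # p) r = p * (h · r)` of the Heisenberg double on `L^*`. -/
def heisenbergAct : Heisenberg k L →ₐ[k] Module.End k (HopfDual k L) :=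
  AlgHom.ofLinearMap (heisenbergActAux k L)
    (LinearMap.ext fun r => by
      rw [Heisenberg.one_def, heisenbergActAux_smash_apply]; simp)
    (fun x y => by
      induction x using smash_induction with
      | zero => simp
      | add a b ha hb => simp only [add_mul, map_add, ha, hb]
      | smash h p =>
      induction y using smash_induction with
      | zero => simp
      | add a b ha hb => simp only [mul_add, map_add, ha, hb]
      | smash g q =>
        refine LinearMap.ext fun r => ?_
        rw [smash_mul_smash_repr (ℛ k h)]
        simp only [map_sum, LinearMap.sum_apply, heisenbergActAux_smash_apply,
          Module.End.mul_apply, act_mul, Finset.mul_sum, act_act, mul_assoc])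

omit [FiniteDimensional k L] in
@[simp] theorem heisenbergAct_smash_apply (h : L) (p r : HopfDual k L) :
    heisenbergAct k L (smash h p) r = p * act h r := rfl

/-- The operators `r ↦ S(h) · (p * r)` already span `End(L^*)`, and each is the action of `(S(h) #
ε)(1 # p)`. Surjectivity follows, and equality of dimensions gives injectivity. -/
theorem heisenbergAct_bijective : Function.Bijective (heisenbergAct k L) := by
  have hsurj : Function.Surjective (heisenbergAct k L) := by
    intro X
    obtain ⟨t, rfl⟩ := antipodeSmashAct_bijective.2 X
    induction t using TensorProduct.induction_on with
    | zero => exact ⟨0, by simp⟩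
    | tmul p h =>
      exact ⟨smash (antipode k h) 1 * smash 1 p, LinearMap.ext fun r => by simp⟩
    | add a b ha hb =>
      obtain ⟨x, hx⟩ := ha
      obtain ⟨y, hy⟩ := hb
      exact ⟨x + y, by rw [map_add, map_add, hx, hy]⟩
  have hfin : FiniteDimensional k (Heisenberg k L) := (equiv k L).finiteDimensional
  have hdim : Module.finrank k (Heisenberg k L) =
      Module.finrank k (Module.End k (HopfDual k L)) := by
    rw [← (equiv k L).finrank_eq, Module.finrank_tensorProduct, Module.finrank_linearMap,
      finrank_hopfDual]
  exact ⟨(LinearMap.injective_iff_surjective_of_finrank_eq_finrank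
    (f := (heisenbergAct k L).toLinearMap) hdim).2 hsurj, hsurj⟩

variable (k L) in
/-- The element of the Heisenberg double acting on `L^*` by `r ↦ r(1) ε`. -/
def heisenbergProj : Heisenberg k L :=
  (AlgEquiv.ofBijective _ heisenbergAct_bijective).symm
    (LinearMap.toSpanSingleton k (HopfDual k L) 1 ∘ₗ dualEval 1)

@[simp] theorem heisenbergAct_heisenbergProj (r : HopfDual k L) :
    heisenbergAct k L (heisenbergProj k L) r = r 1 • 1 :=
  congrArg (fun X : Module.End k (HopfDual k L) => X r)
    ((AlgEquiv.ofBijective _ heisenbergAct_bijective).apply_symm_apply _)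

theorem heisenberg_ext {x y : Heisenberg k L}
    (h : ∀ r, heisenbergAct k L x r = heisenbergAct k L y r) : x = y :=
  heisenbergAct_bijective.1 (LinearMap.ext h)

theorem smash_mul_heisenbergProj (x : L) :
    smash x 1 * heisenbergProj k L = counit (R := k) x • heisenbergProj k L :=
  heisenberg_ext fun r => by
    simp [act_one, smul_comm (r 1)]

theorem heisenbergProj_mul_smash (p : HopfDual k L) :
    heisenbergProj k L * smash 1 p = p 1 • heisenbergProj k L :=
  heisenberg_ext fun r => by simp [HopfDual.mul_apply, Algebra.TensorProduct.one_def, mul_smul]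

theorem smash_mul_smash_mul_heisenbergProj (x : L) (p : HopfDual k L) :
    smash x 1 * smash 1 p * heisenbergProj k L = smash 1 (act x p) * heisenbergProj k L :=
  heisenberg_ext fun r => by simp

theorem heisenbergProj_mul_smash_mul_smash {ι : Type*} {x : L} (s : Coalgebra.Repr k x ι)
    (p : HopfDual k L) :
    heisenbergProj k L * smash x 1 * smash 1 p =
      ∑ i ∈ s.index, p (s.left i) • (heisenbergProj k L * smash (s.right i) 1) :=
  heisenberg_ext fun r => by simp [HopfDual.mul_apply_repr _ _ s, Finset.sum_smul, mul_smul]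

section Basis

variable {ι : Type*} (b : Module.Basis ι k L)

/-- The linear form dual to the `i`-th basis vector. -/
def dualVec (i : ι) : HopfDual k L := (HopfDual.equiv k L).symm (b.coord i)

omit [FiniteDimensional k L] in
@[simp] theorem dualVec_apply (i : ι) (x : L) : dualVec b i x = b.repr x i := rfl

variable [Fintype ι]

omit [FiniteDimensional k L] in
theorem sum_apply_smul_dualVec (p : HopfDual k L) : ∑ i, p (b i) • dualVec b i = p := by
  ext x
  conv_rhs => rw [← b.sum_repr x, map_sum]
  simp [mul_comm]

/-- On `r`, the `i`-th summand gives `r(eᵢ) eᵢ^*`, so the sum is the expansion of `r` in the dual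
basis. -/
theorem sum_dualVec_mul_heisenbergProj_mul :
    ∑ i, smash 1 (dualVec b i) * heisenbergProj k L * smash (b i) 1 = 1 :=
  heisenberg_ext fun r => by simp [sum_apply_smul_dualVec]

end Basis

end LarsonSweedler

/-! ### Tensor decompositions of algebras receiving a Heisenberg double. -/

section HeisenbergModules

open Coalgebra HopfAlgebra Heisenberg

variable {k : Type u} {L : Type v} [Field k] [Ring L] [HopfAlgebra k L] [FiniteDimensional k L]
  {A : Type*} [Ring A] [Algebra k A] (F : Heisenberg k L →ₐ[k] A)

/-- An algebra containing an image of the Heisenberg double of `L` is the tensor product of its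
right coinvariants and `L`. -/
theorem exists_coinvariants_tensor_equiv (C : Submodule k A)
    (hC : ∀ a, a ∈ C ↔ ∀ p : HopfDual k L, a * F (smash 1 p) = p 1 • a) :
    ∃ μ : C ⊗[k] L ≃ₗ[k] A, ∀ (a : C) (x : L), μ (a ⊗ₜ x) = (a : A) * F (smash x 1) := by
  let b := Module.finBasis k L
  let W := F (heisenbergProj k L)
  -- The relation `W (1 # p) = p(1) W` puts `a W` in `C`, so right multiplication by `W` is a map `E
  -- : A → C`.
  have hW : ∀ a, a * W ∈ C := fun a => (hC _).2 fun p => by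
    rw [mul_assoc, ← map_mul, heisenbergProj_mul_smash, map_smul, mul_smul_comm]
  let E : A →ₗ[k] C := (LinearMap.mulRight k W).codRestrict C hW
  have hres : ∀ a, ∑ i, a * F (smash 1 (dualVec b i)) * W * F (smash (b i) 1) = a := by
    intro a
    have := congrArg (fun y => a * F y) (sum_dualVec_mul_heisenbergProj_mul b)
    simpa only [map_one, map_sum, map_mul, mul_one, Finset.mul_sum, ← mul_assoc] using this
  -- For `a ∈ C` the resolution of the identity collapses to `a W` times `∑ eᵢ^*(1) eᵢ = 1`, so `E`
  -- fixes `C`.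
  have hE : ∀ a : C, E a = a := by
    intro a
    refine Subtype.ext ?_
    have h1 := hres a
    simp only [(hC _).1 a.2, smul_mul_assoc] at h1
    simp only [← mul_smul_comm] at h1
    rw [← Finset.mul_sum] at h1
    simp only [← map_smul, ← smash_smul_left, ← map_sum, ← smash_sum_left] at h1
    simp only [dualVec_apply, b.sum_repr] at h1
    rw [← Heisenberg.one_def, map_one, mul_one] at h1
    exact h1
  let μ : C ⊗[k] L →ₗ[k] A := TensorProduct.lift (LinearMap.mk₂ k
    (fun (a : C) x => (a : A) * F (smash x 1))
    (fun _ _ _ => by simp [add_mul]) (fun _ _ _ => by simp)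
    (fun _ _ _ => by simp [smash_add_left, mul_add]) (fun _ _ _ => by simp [smash_smul_left]))
  -- The inverse is read off from `a = ∑ (a eᵢ^* W) eᵢ`.
  let ν : A →ₗ[k] C ⊗[k] L := ∑ i, (TensorProduct.mk k C L).flip (b i) ∘ₗ E ∘ₗ
    LinearMap.mulRight k (F (smash 1 (dualVec b i)))
  have hν : ∀ a, ν a = ∑ i, E (a * F (smash 1 (dualVec b i))) ⊗ₜ b i := fun a => by
    simp [ν]
  refine ⟨LinearEquiv.ofLinearMap μ ν ?_ ?_, fun a x => rfl⟩
  · refine LinearMap.ext fun a => ?_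
    rw [LinearMap.comp_apply, hν, map_sum]
    exact hres a
  · refine TensorProduct.ext' fun a x => ?_
    rw [LinearMap.comp_apply, hν]
    -- The relation `x p W = (x · p) W` turns the product into `a (x · p) W`, and coinvariance of
    -- `a` evaluates `x · p` at `1`, which gives `p(x)`.
    have h1 : ∀ p : HopfDual k L,
        E (a * F (smash x 1) * F (smash 1 p)) = p x • a := by
      intro p
      refine (Subtype.ext ?_ : E _ = E ((a : A) * F (smash 1 (act x p)))).trans ?_
      · change _ * _ * _ * F _ = _ * _ * F _
        simp only [mul_assoc, ← map_mul]
        rw [← mul_assoc, smash_mul_smash_mul_heisenbergProj]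
      · rw [(hC _).1 a.2, map_smul, hE, act_apply, one_mul]
    change ∑ i, E (a * F (smash x 1) * F (smash 1 (dualVec b i))) ⊗ₜ b i = a ⊗ₜ x
    simp only [h1, TensorProduct.smul_tmul, ← TensorProduct.tmul_sum,
      dualVec_apply, b.sum_repr]

/-- An algebra containing an image of the Heisenberg double of `L` is the tensor product of `L^*`
and its left coinvariants. -/
theorem exists_tensor_coinvariants_equiv (C : Submodule k A)
    (hC : ∀ a, a ∈ C ↔ ∀ x : L, F (smash x 1) * a = counit (R := k) x • a) :
    ∃ μ : HopfDual k L ⊗[k] C ≃ₗ[k] A,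
      ∀ (p : HopfDual k L) (a : C), μ (p ⊗ₜ a) = F (smash 1 p) * (a : A) := by
  let b := Module.finBasis k L
  let W := F (heisenbergProj k L)
  have hW : ∀ a, W * a ∈ C := fun a => (hC _).2 fun x => by
    rw [← mul_assoc, ← map_mul, smash_mul_heisenbergProj, map_smul, smul_mul_assoc]
  let E : A →ₗ[k] C := (LinearMap.mulLeft k W).codRestrict C hW
  have hres : ∀ a, ∑ i, F (smash 1 (dualVec b i)) * (W * (F (smash (b i) 1) * a)) = a := by
    intro a
    have := congrArg (fun y => F y * a) (sum_dualVec_mul_heisenbergProj_mul b)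
    simpa only [map_one, map_sum, map_mul, one_mul, Finset.sum_mul, mul_assoc] using this
  have hE : ∀ a : C, E a = a := by
    intro a
    refine Subtype.ext ?_
    have h1 := hres a
    simp only [(hC _).1 a.2, mul_smul_comm] at h1
    simp only [← smul_mul_assoc] at h1
    rw [← Finset.sum_mul] at h1
    simp only [← map_smul, ← smash_smul_right, ← map_sum, ← smash_sum_right] at h1
    simp only [← HopfDual.one_apply, sum_apply_smul_dualVec] at h1
    rw [← Heisenberg.one_def, map_one, one_mul] at h1
    exact h1
  let μ : HopfDual k L ⊗[k] C →ₗ[k] A := TensorProduct.lift (LinearMap.mk₂ k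
    (fun p (a : C) => F (smash 1 p) * (a : A))
    (fun _ _ _ => by simp [smash_add_right, add_mul]) (fun _ _ _ => by simp [smash_smul_right])
    (fun _ _ _ => by simp [mul_add]) (fun _ _ _ => by simp))
  let ν : A →ₗ[k] HopfDual k L ⊗[k] C := ∑ i, TensorProduct.mk k (HopfDual k L) C (dualVec b i) ∘ₗ
    E ∘ₗ LinearMap.mulLeft k (F (smash (b i) 1))
  have hν : ∀ a, ν a = ∑ i, dualVec b i ⊗ₜ E (F (smash (b i) 1) * a) := fun a => by
    simp [ν]
  refine ⟨LinearEquiv.ofLinearMap μ ν ?_ ?_, fun a x => rfl⟩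
  · refine LinearMap.ext fun a => ?_
    rw [LinearMap.comp_apply, hν, map_sum]
    exact hres a
  · refine TensorProduct.ext' fun p a => ?_
    rw [LinearMap.comp_apply, hν]
    -- Here `W x p = ∑ p(x₁) W x₂`; coinvariance replaces `x₂` by `ε(x₂)`, and `p * ε = p` finishes.
    have h1 : ∀ x : L, E (F (smash x 1) * (F (smash 1 p) * a)) = p x • a := by
      intro x
      conv_rhs => rw [← hE a]
      refine Subtype.ext ?_
      change F _ * (F _ * (F _ * (a : A))) = p x • (F _ * (a : A))
      rw [← mul_assoc, ← mul_assoc, ← map_mul, ← map_mul,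
        heisenbergProj_mul_smash_mul_smash (ℛ k x)]
      simp only [map_sum, map_smul, map_mul, Finset.sum_mul, smul_mul_assoc, mul_assoc,
        (hC _).1 a.2, mul_smul_comm, smul_smul]
      rw [← Finset.sum_smul]
      congr 1
      conv_rhs => rw [← mul_one p, HopfDual.mul_apply_repr _ _ (ℛ k x)]
      rfl
    change ∑ i, dualVec b i ⊗ₜ E (F (smash (b i) 1) * (F (smash 1 p) * a)) = p ⊗ₜ a
    simp only [h1, ← TensorProduct.smul_tmul, ← TensorProduct.sum_tmul, sum_apply_smul_dualVec]

end HeisenbergModules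

/-! ### Coefficient spaces and the contracted pentagon equation. -/

section Coefficients

variable {k : Type u} {A : Type v} [Field k] [Ring A] [Algebra k A]

section Contract

variable {V W : Type*} [AddCommGroup V] [Module k V] [AddCommGroup W] [Module k W]

@[simp] theorem contractFst_tmul (φ : Module.Dual k V) (v : V) (w : W) :
    contractFst φ (v ⊗ₜ[k] w) = φ v • w := by simp [contractFst]

@[simp] theorem contractSnd_tmul (φ : Module.Dual k W) (v : V) (w : W) :
    contractSnd φ (v ⊗ₜ[k] w) = φ w • v := by simp [contractSnd]

end Contract

theorem contractSnd_eq_sum {n : ℕ} {a b : Fin n → A} {R : A ⊗[k] A}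
    (h : ∑ i, a i ⊗ₜ[k] b i = R) (φ : Module.Dual k A) :
    contractSnd φ R = ∑ i, φ (b i) • a i := by
  simp [← h]

theorem contractFst_eq_sum {n : ℕ} {a b : Fin n → A} {R : A ⊗[k] A}
    (h : ∑ i, a i ⊗ₜ[k] b i = R) (φ : Module.Dual k A) :
    contractFst φ R = ∑ i, φ (a i) • b i := by
  simp [← h]

theorem exists_fin_sum_tmul {V W : Type*} [AddCommGroup V] [Module k V] [AddCommGroup W]
    [Module k W] (t : V ⊗[k] W) :
    ∃ (n : ℕ) (a : Fin n → V) (b : Fin n → W), ∑ i, a i ⊗ₜ[k] b i = t := by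
  obtain ⟨s, rfl⟩ := TensorProduct.exists_finset t
  refine ⟨s.card, fun i => (s.equivFin.symm i).1.1, fun i => (s.equivFin.symm i).1.2, ?_⟩
  rw [← Finset.sum_coe_sort s]
  exact Fintype.sum_equiv s.equivFin.symm _ _ fun _ => rfl

/-- A tensor is a sum of elementary tensors in its left and right coefficients. -/
theorem exists_sum_tmul_mem_coeff (R : A ⊗[k] A) :
    ∃ (n : ℕ) (a : Fin n → leftCoeff R) (b : Fin n → rightCoeff R),
      ∑ i, (a i : A) ⊗ₜ[k] (b i : A) = R := by
  classical
  obtain ⟨t, ht⟩ : ∃ t : A ⊗[k] rightCoeff R, (rightCoeff R).subtype.lTensor A t = R := by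
    -- Expanding the left factor in a basis of `A`, the right factors are the contractions of `R`
    -- with the coordinate forms, so they are right coefficients.
    let e := Module.Basis.ofVectorSpace k A
    obtain ⟨c, hc⟩ := TensorProduct.eq_repr_basis_left e R
    have hmem : ∀ i, c i ∈ rightCoeff R := fun i => ⟨e.coord i, by
      rw [← hc, Finsupp.sum, map_sum]
      simp +contextual [Finsupp.single_apply, eq_comm]⟩
    refine ⟨c.sum fun i _ => e i ⊗ₜ ⟨c i, hmem i⟩, ?_⟩
    conv_rhs => rw [← hc]
    rw [Finsupp.sum, Finsupp.sum, map_sum]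
    rfl
  let e := Module.Basis.ofVectorSpace k (rightCoeff R)
  obtain ⟨c, hc⟩ := TensorProduct.eq_repr_basis_right e t
  have hmem : ∀ i, c i ∈ leftCoeff R := fun i => by
    -- Coordinates are now forms on `rightCoeff R` only; they must be extended to `A` to exhibit `c
    -- i` as a left coefficient.
    obtain ⟨φ, hφ⟩ := LinearMap.exists_extend (e.coord i)
    refine ⟨φ, ?_⟩
    have hφ' : ∀ y : rightCoeff R, φ y = e.coord i y := fun y =>
      congrArg (fun g : Module.Dual k (rightCoeff R) => g y) hφ
    refine (congrArg (contractSnd φ) (ht.symm.trans (congrArg _ hc.symm))).trans ?_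
    rw [Finsupp.sum, map_sum, map_sum]
    simp +contextual [hφ', Finsupp.single_apply, eq_comm]
  obtain ⟨n, a, b, hab⟩ := exists_fin_sum_tmul
    (c.sum fun i _ => (⟨c i, hmem i⟩ : leftCoeff R) ⊗ₜ[k] e i)
  refine ⟨n, a, b, ?_⟩
  have h1 := congrArg (TensorProduct.map (leftCoeff R).subtype (rightCoeff R).subtype) hab
  rw [map_sum, Finsupp.sum, map_sum] at h1
  refine Eq.trans ?_ ((congrArg _ hc).trans ht)
  rw [Finsupp.sum, map_sum]
  exact h1

theorem exists_tensorLength (R : A ⊗[k] A) :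
    ∃ a b : Fin (tensorLength R) → A, ∑ i, a i ⊗ₜ[k] b i = R := by
  obtain ⟨n, a, b, h⟩ := exists_fin_sum_tmul R
  obtain ⟨a', b', h'⟩ : tensorLength R ∈ {m : ℕ | ∃ a b : Fin m → A, R = ∑ i, a i ⊗ₜ[k] b i} :=
    Nat.sInf_mem ⟨n, a, b, h.symm⟩
  exact ⟨a', b', h'.symm⟩

theorem leftCoeff_le_span {n : ℕ} {a b : Fin n → A} {R : A ⊗[k] A}
    (h : ∑ i, a i ⊗ₜ[k] b i = R) : leftCoeff R ≤ Submodule.span k (Set.range a) := by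
  rintro _ ⟨φ, rfl⟩
  rw [contractSnd_eq_sum h]
  exact Submodule.sum_mem _ fun i _ =>
    Submodule.smul_mem _ _ (Submodule.subset_span ⟨i, rfl⟩)

theorem rightCoeff_le_span {n : ℕ} {a b : Fin n → A} {R : A ⊗[k] A}
    (h : ∑ i, a i ⊗ₜ[k] b i = R) : rightCoeff R ≤ Submodule.span k (Set.range b) := by
  rintro _ ⟨φ, rfl⟩
  rw [contractFst_eq_sum h]
  exact Submodule.sum_mem _ fun i _ =>
    Submodule.smul_mem _ _ (Submodule.subset_span ⟨i, rfl⟩)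

instance (R : A ⊗[k] A) : FiniteDimensional k (leftCoeff R) := by
  obtain ⟨a, b, h⟩ := exists_tensorLength R
  have : FiniteDimensional k (Submodule.span k (Set.range a)) :=
    FiniteDimensional.span_of_finite k (Set.finite_range a)
  exact Submodule.finiteDimensional_of_le (leftCoeff_le_span h)

instance (R : A ⊗[k] A) : FiniteDimensional k (rightCoeff R) := by
  obtain ⟨a, b, h⟩ := exists_tensorLength R
  have : FiniteDimensional k (Submodule.span k (Set.range b)) :=
    FiniteDimensional.span_of_finite k (Set.finite_range b)
  exact Submodule.finiteDimensional_of_le (rightCoeff_le_span h)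

theorem finrank_leftCoeff_le (R : A ⊗[k] A) :
    Module.finrank k (leftCoeff R) ≤ tensorLength R := by
  obtain ⟨a, b, h⟩ := exists_tensorLength R
  have : FiniteDimensional k (Submodule.span k (Set.range a)) :=
    FiniteDimensional.span_of_finite k (Set.finite_range a)
  refine (Submodule.finrank_mono (leftCoeff_le_span h)).trans ?_
  exact (finrank_range_le_card (R := k) a).trans (by simp)

/-- The linear form `φ ⊗ ψ`. -/
def tensorForm (φ ψ : Module.Dual k A) : Module.Dual k (A ⊗[k] A) :=
  LinearMap.mul' k k ∘ₗ TensorProduct.map φ ψ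

@[simp] theorem tensorForm_tmul (φ ψ : Module.Dual k A) (a b : A) :
    tensorForm φ ψ (a ⊗ₜ b) = φ a * ψ b := rfl

@[simp] theorem leg12_tmul (a b : A) : leg12 (a ⊗ₜ[k] b) = a ⊗ₜ (b ⊗ₜ 1) := rfl

@[simp] theorem leg13_tmul (a b : A) : leg13 (a ⊗ₜ[k] b) = a ⊗ₜ ((1 : A) ⊗ₜ b) := rfl

@[simp] theorem leg23_tmul (a b : A) : leg23 (a ⊗ₜ[k] b) = (1 : A) ⊗ₜ (a ⊗ₜ b) := rfl

variable {R : (A ⊗[k] A)ˣ}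

theorem IsPentagon.leg12_mul_leg13 (h : IsPentagon (R : A ⊗[k] A)) :
    leg12 (R : A ⊗[k] A) * leg13 (R : A ⊗[k] A) =
      leg23 (R : A ⊗[k] A) * leg12 (R : A ⊗[k] A) * leg23 (↑R⁻¹ : A ⊗[k] A) := by
  rw [← show _ = _ from h, mul_assoc _ (leg23 _) (leg23 _), ← map_mul, Units.mul_inv, map_one,
    mul_one]

theorem IsPentagon.leg13_mul_leg23 (h : IsPentagon (R : A ⊗[k] A)) :
    leg13 (R : A ⊗[k] A) * leg23 (R : A ⊗[k] A) =
      leg12 (↑R⁻¹ : A ⊗[k] A) * leg23 (R : A ⊗[k] A) * leg12 (R : A ⊗[k] A) := by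
  rw [mul_assoc, ← show _ = _ from h, mul_assoc (leg12 _), ← mul_assoc, ← map_mul, Units.inv_mul,
    map_one, one_mul]

variable {n : ℕ} {a b : Fin n → A}

/-- `Δ(x) = R⁻¹ (1 ⊗ x) R` is dual to the multiplication of right coefficients. -/
theorem IsPentagon.conj_one_tmul (h : IsPentagon (R : A ⊗[k] A))
    (hab : ∑ i, a i ⊗ₜ[k] b i = (R : A ⊗[k] A)) (φ : Module.Dual k A) :
    (↑R⁻¹ : A ⊗[k] A) * ((1 : A) ⊗ₜ ∑ i, φ (b i) • a i) * (R : A ⊗[k] A) =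
      ∑ i, ∑ j, φ (b i * b j) • (a i ⊗ₜ[k] a j) := by
  -- Contracting the third leg sees only the middle factor `leg23`, because `leg12` is `1` there.
  have key : ∀ (r s : A ⊗[k] A) (x y : A),
      (contractSnd φ).lTensor A (leg12 r * leg23 (x ⊗ₜ y) * leg12 s) =
        φ y • (r * ((1 : A) ⊗ₜ x) * s) := by
    intro r s x y
    induction r using TensorProduct.induction_on with
    | zero => simp
    | add r r' hr hr' => simp only [map_add, add_mul, hr, hr', smul_add]
    | tmul c d =>
    induction s using TensorProduct.induction_on with
    | zero => simp
    | add r r' hr hr' => simp only [map_add, mul_add, hr, hr', smul_add]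
    | tmul c' d' => simp
  have key' : ∀ r s z : A ⊗[k] A, ∑ i, a i ⊗ₜ[k] b i = z →
      (contractSnd φ).lTensor A (leg12 r * leg23 z * leg12 s) =
        r * ((1 : A) ⊗ₜ ∑ i, φ (b i) • a i) * s := by
    rintro r s z rfl
    simp only [map_sum, Finset.mul_sum, Finset.sum_mul, key, TensorProduct.tmul_sum,
      TensorProduct.tmul_smul, mul_smul_comm, smul_mul_assoc]
  rw [← key' _ _ _ hab, ← h.leg13_mul_leg23, ← hab]
  simp only [map_sum, Finset.sum_mul_sum, leg13_tmul, leg23_tmul,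
    Algebra.TensorProduct.tmul_mul_tmul, mul_one, one_mul, LinearMap.lTensor_tmul,
    contractSnd_tmul, TensorProduct.tmul_smul]

/-- `Δ(y) = R (y ⊗ 1) R⁻¹` is dual to the multiplication of left coefficients. -/
theorem IsPentagon.conj_tmul_one (h : IsPentagon (R : A ⊗[k] A))
    (hab : ∑ i, a i ⊗ₜ[k] b i = (R : A ⊗[k] A)) (φ : Module.Dual k A) :
    (R : A ⊗[k] A) * ((∑ i, φ (a i) • b i) ⊗ₜ (1 : A)) * (↑R⁻¹ : A ⊗[k] A) =
      ∑ i, ∑ j, φ (a i * a j) • (b i ⊗ₜ[k] b j) := by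
  have key : ∀ (r s : A ⊗[k] A) (x y : A),
      contractFst φ (leg23 r * leg12 (x ⊗ₜ y) * leg23 s) = φ x • (r * (y ⊗ₜ (1 : A)) * s) := by
    intro r s x y
    simp [leg23]
  have key' : ∀ r s z : A ⊗[k] A, ∑ i, a i ⊗ₜ[k] b i = z →
      contractFst φ (leg23 r * leg12 z * leg23 s) =
        r * ((∑ i, φ (a i) • b i) ⊗ₜ (1 : A)) * s := by
    rintro r s z rfl
    simp only [map_sum, Finset.mul_sum, Finset.sum_mul, key, TensorProduct.sum_tmul,
      ← TensorProduct.smul_tmul', mul_smul_comm, smul_mul_assoc]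
  rw [← key' _ _ _ hab, ← h.leg12_mul_leg13, ← hab]
  simp only [map_sum, Finset.sum_mul_sum, leg13_tmul, leg12_tmul,
    Algebra.TensorProduct.tmul_mul_tmul, mul_one, one_mul, contractFst_tmul]

/-- The commutation rule of left and right coefficients. -/
theorem IsPentagon.coeff_mul_coeff (h : IsPentagon (R : A ⊗[k] A))
    (hab : ∑ i, a i ⊗ₜ[k] b i = (R : A ⊗[k] A)) (φ ψ : Module.Dual k A) :
    (∑ j, ψ (b j) • a j) * (∑ i, φ (a i) • b i) =
      ∑ i, ∑ j, ∑ l, (φ (a i * a j) * ψ (b j * b l)) • (b i * a l) := by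
  -- Applying `φ ⊗ id ⊗ ψ` to the pentagon; what remains is reordering of sums.
  have h1 := congrArg (contractFst (W := A) φ ∘ₗ (contractSnd (V := A) ψ).lTensor A) h
  rw [← hab] at h1
  simp only [map_sum, Finset.sum_mul, Finset.mul_sum, leg12_tmul, leg13_tmul,
    leg23_tmul, Algebra.TensorProduct.tmul_mul_tmul, mul_one, one_mul, LinearMap.comp_apply,
    LinearMap.lTensor_tmul, contractFst_tmul, contractSnd_tmul, smul_smul] at h1
  simp only [Finset.sum_mul_sum, smul_mul_smul_comm]
  rw [Finset.sum_comm]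
  simp only [mul_comm (ψ _)]
  rw [Finset.sum_comm, Finset.sum_comm, ← h1]
  refine (Finset.sum_congr rfl fun _ _ => Finset.sum_comm).trans (Finset.sum_comm.trans ?_)
  exact Finset.sum_congr rfl fun _ _ => Finset.sum_comm

end Coefficients

/-! ### The algebras `P` and `H`, their pairing, and the structure maps of `P`. -/

section Factorization

variable {k : Type u} {A : Type v} [Field k] [Ring A] [Algebra k A]

theorem eq_of_forall_dual {V : Type*} [AddCommGroup V] [Module k V] {x y : V}
    (h : ∀ φ : Module.Dual k V, φ x = φ y) : x = y :=
  sub_eq_zero.1 <| (Module.forall_dual_apply_eq_zero_iff k _).1 fun φ => by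
    rw [map_sub, h, sub_self]

theorem map_val_injective (P Q : Subalgebra k A) :
    Function.Injective (Algebra.TensorProduct.map P.val Q.val) :=
  TensorProduct.map_injective_of_flat_flat P.val.toLinearMap Q.val.toLinearMap
    Subtype.val_injective Subtype.val_injective

/-- The product of the coefficients at `φ` and `ψ` is the coefficient at `χ = (φ ⊗ ψ)(R (· ⊗ 1)
R⁻¹)`, since that conjugation is transpose to multiplying left coefficients. Equality is tested
against all forms `θ`. -/
theorem IsPentagon.leftCoeff_mul_mem {R : (A ⊗[k] A)ˣ} (h : IsPentagon (R : A ⊗[k] A)) {x y : A}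
    (hx : x ∈ leftCoeff (R : A ⊗[k] A)) (hy : y ∈ leftCoeff (R : A ⊗[k] A)) :
    x * y ∈ leftCoeff (R : A ⊗[k] A) := by
  obtain ⟨φ, rfl⟩ := hx
  obtain ⟨ψ, rfl⟩ := hy
  obtain ⟨n, a, b, hab⟩ := exists_fin_sum_tmul (R : A ⊗[k] A)
  let χ : Module.Dual k A := tensorForm φ ψ ∘ₗ LinearMap.mulRight k (↑R⁻¹ : A ⊗[k] A) ∘ₗ
    LinearMap.mulLeft k (R : A ⊗[k] A) ∘ₗ (TensorProduct.mk k A A).flip 1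
  have hχ : ∀ y, χ y = tensorForm φ ψ ((R : A ⊗[k] A) * (y ⊗ₜ 1) * (↑R⁻¹ : A ⊗[k] A)) :=
    fun _ => rfl
  refine ⟨χ, eq_of_forall_dual (k := k) fun θ => ?_⟩
  have h1 : θ (contractSnd χ (R : A ⊗[k] A)) = χ (∑ i, θ (a i) • b i) := by
    simp [contractSnd_eq_sum hab, mul_comm]
  rw [h1, hχ, h.conj_tmul_one hab, contractSnd_eq_sum hab, contractSnd_eq_sum hab,
    Finset.sum_mul_sum]
  simp [mul_comm, mul_left_comm]

theorem IsPentagon.rightCoeff_mul_mem {R : (A ⊗[k] A)ˣ} (h : IsPentagon (R : A ⊗[k] A)) {x y : A}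
    (hx : x ∈ rightCoeff (R : A ⊗[k] A)) (hy : y ∈ rightCoeff (R : A ⊗[k] A)) :
    x * y ∈ rightCoeff (R : A ⊗[k] A) := by
  obtain ⟨φ, rfl⟩ := hx
  obtain ⟨ψ, rfl⟩ := hy
  obtain ⟨n, a, b, hab⟩ := exists_fin_sum_tmul (R : A ⊗[k] A)
  let χ : Module.Dual k A := tensorForm φ ψ ∘ₗ LinearMap.mulRight k (R : A ⊗[k] A) ∘ₗ
    LinearMap.mulLeft k (↑R⁻¹ : A ⊗[k] A) ∘ₗ TensorProduct.mk k A A 1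
  have hχ : ∀ y, χ y = tensorForm φ ψ ((↑R⁻¹ : A ⊗[k] A) * (1 ⊗ₜ y) * (R : A ⊗[k] A)) :=
    fun _ => rfl
  refine ⟨χ, eq_of_forall_dual (k := k) fun θ => ?_⟩
  have h1 : θ (contractFst χ (R : A ⊗[k] A)) = χ (∑ i, θ (b i) • a i) := by
    simp [contractFst_eq_sum hab, mul_comm]
  rw [h1, hχ, h.conj_one_tmul hab, contractFst_eq_sum hab, contractFst_eq_sum hab,
    Finset.sum_mul_sum]
  simp [mul_comm, mul_left_comm]

/-- Decompositions of `R` and `R⁻¹` in the tensor product of the algebras of left and right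
coefficients of `R`. -/
structure Factorization (R : (A ⊗[k] A)ˣ) where
  /-- The algebra of left coefficients. -/
  P : Subalgebra k A
  /-- The algebra of right coefficients. -/
  H : Subalgebra k A
  toSubmodule_P : Subalgebra.toSubmodule P = leftCoeff (R : A ⊗[k] A)
  toSubmodule_H : Subalgebra.toSubmodule H = rightCoeff (R : A ⊗[k] A)
  /-- The number of terms of `R`. -/
  n : ℕ
  /-- The left factors of `R`. -/
  a : Fin n → P
  /-- The right factors of `R`. -/
  b : Fin n → H
  /-- The number of terms of `R⁻¹`. -/
  m : ℕ
  /-- The left factors of `R⁻¹`. -/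
  c : Fin m → P
  /-- The right factors of `R⁻¹`. -/
  d : Fin m → H
  sum_ab : ∑ i, (a i : A) ⊗ₜ[k] (b i : A) = (R : A ⊗[k] A)
  sum_cd : ∑ i, (c i : A) ⊗ₜ[k] (d i : A) = (↑R⁻¹ : A ⊗[k] A)

/-- The point is that `R⁻¹` also lies in `P ⊗ H`. Multiplication by `R` on this finite dimensional
algebra is injective because `R` is invertible in `A ⊗ A`, hence it reaches `1`. -/
theorem IsPentagon.nonempty_factorization {R : (A ⊗[k] A)ˣ} (h : IsPentagon (R : A ⊗[k] A))
    (hu : IsUnitary (R : A ⊗[k] A)) : Nonempty (Factorization R) := by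
  let P : Subalgebra k A := (leftCoeff (R : A ⊗[k] A)).toSubalgebra hu.1
    fun _ _ => h.leftCoeff_mul_mem
  let H : Subalgebra k A := (rightCoeff (R : A ⊗[k] A)).toSubalgebra hu.2
    fun _ _ => h.rightCoeff_mul_mem
  have : FiniteDimensional k P := inferInstanceAs (FiniteDimensional k (leftCoeff (R : A ⊗[k] A)))
  have : FiniteDimensional k H :=
    inferInstanceAs (FiniteDimensional k (rightCoeff (R : A ⊗[k] A)))
  obtain ⟨n, a, b, hab⟩ := exists_sum_tmul_mem_coeff (R : A ⊗[k] A)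
  let a' : Fin n → P := a
  let b' : Fin n → H := b
  let ρ : P ⊗[k] H := ∑ i, a' i ⊗ₜ b' i
  let ι := Algebra.TensorProduct.map P.val H.val
  have hι : Function.Injective ι := map_val_injective P H
  have hρ : ι ρ = R := by
    rw [← hab, map_sum]; rfl
  have hinj : Function.Injective (LinearMap.mulLeft k ρ) := by
    intro s t hst
    have h1 : ι ρ * ι s = ι ρ * ι t := by simpa using congrArg ι hst
    rw [hρ] at h1
    exact hι (R.isUnit.mul_left_cancel h1)
  obtain ⟨t, ht⟩ := LinearMap.injective_iff_surjective.1 hinj 1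
  have ht' : ι t = (↑R⁻¹ : A ⊗[k] A) := by
    have h1 : ι ρ * ι t = 1 := by simpa using congrArg ι ht
    rw [hρ] at h1
    rw [← R.inv_mul_cancel_left (ι t), h1, mul_one]
  obtain ⟨m, c, d, hcd⟩ := exists_fin_sum_tmul t
  refine ⟨⟨P, H, rfl, rfl, n, a', b', m, c, d, hab, ?_⟩⟩
  rw [← ht', ← hcd, map_sum]
  rfl

namespace Factorization

variable {R : (A ⊗[k] A)ˣ} (D : Factorization R)

instance : FiniteDimensional k D.P := by
  change FiniteDimensional k (Subalgebra.toSubmodule D.P)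
  rw [D.toSubmodule_P]
  infer_instance

instance : FiniteDimensional k D.H := by
  change FiniteDimensional k (Subalgebra.toSubmodule D.H)
  rw [D.toSubmodule_H]
  infer_instance

theorem finrank_P_le : Module.finrank k D.P ≤ tensorLength (R : A ⊗[k] A) := by
  change Module.finrank k (Subalgebra.toSubmodule D.P) ≤ _
  rw [D.toSubmodule_P]
  exact finrank_leftCoeff_le _

/-- The left coefficient of `R` at a linear form. -/
def left : Module.Dual k A →ₗ[k] D.P :=
  ∑ i, (LinearMap.toSpanSingleton k D.P (D.a i)) ∘ₗ LinearMap.applyₗ (D.b i : A)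

theorem left_apply (φ : Module.Dual k A) : D.left φ = ∑ i, φ (D.b i) • D.a i := by
  simp [left]

theorem coe_left (φ : Module.Dual k A) : (D.left φ : A) = ∑ i, φ (D.b i) • (D.a i : A) := by
  simp [left_apply]

theorem left_surjective : Function.Surjective D.left := by
  intro x
  have hx : (x : A) ∈ leftCoeff (R : A ⊗[k] A) := by
    rw [← D.toSubmodule_P]; exact x.2
  obtain ⟨φ, hφ⟩ := hx
  refine ⟨φ, Subtype.ext ?_⟩
  rw [coe_left, ← hφ, contractSnd_eq_sum D.sum_ab]

/-- The right coefficient of `R` at a linear form on the left coefficients. -/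
def right : Module.Dual k D.P →ₗ[k] D.H :=
  ∑ i, (LinearMap.toSpanSingleton k D.H (D.b i)) ∘ₗ LinearMap.applyₗ (D.a i)

theorem right_apply (p : Module.Dual k D.P) : D.right p = ∑ i, p (D.a i) • D.b i := by
  simp [right]

theorem coe_right (p : Module.Dual k D.P) : (D.right p : A) = ∑ i, p (D.a i) • (D.b i : A) := by
  simp [right_apply]

/-- The pairing between `P` and `H` given by `R`. Most later facts about `P` and `H` are transferred
across it. -/
theorem apply_right (φ : Module.Dual k A) (p : Module.Dual k D.P) :
    φ (D.right p) = p (D.left φ) := by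
  simp [coe_right, left_apply, mul_comm]

theorem exists_extend (p : Module.Dual k D.P) : ∃ φ : Module.Dual k A, ∀ x : D.P, φ x = p x := by
  obtain ⟨φ, hφ⟩ := LinearMap.exists_extend (p := Subalgebra.toSubmodule D.P) p
  exact ⟨φ, fun x => congrArg (fun g : Module.Dual k D.P => g x) hφ⟩

theorem right_bijective : Function.Bijective D.right := by
  refine ⟨(injective_iff_map_eq_zero _).2 fun p hp => LinearMap.ext fun x => ?_, fun y => ?_⟩
  · obtain ⟨φ, rfl⟩ := D.left_surjective x
    rw [← apply_right, hp]
    simp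
  · have hy : (y : A) ∈ rightCoeff (R : A ⊗[k] A) := by
      rw [← D.toSubmodule_H]; exact y.2
    obtain ⟨φ, hφ⟩ := hy
    refine ⟨φ ∘ₗ D.P.val.toLinearMap, Subtype.ext ?_⟩
    rw [coe_right, ← hφ, contractFst_eq_sum D.sum_ab]
    rfl

/-- The antipode of the algebra of left coefficients. -/
theorem exists_antipode :
    ∃ S : D.P →ₗ[k] D.P, ∀ φ : Module.Dual k A, S (D.left φ) = ∑ j, φ (D.d j) • D.c j := by
  obtain ⟨σ, hσ⟩ := LinearMap.exists_rightInverse_of_surjective D.left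
    (LinearMap.range_eq_top.2 D.left_surjective)
  let g : Module.Dual k A →ₗ[k] D.P :=
    ∑ j, (LinearMap.toSpanSingleton k D.P (D.c j)) ∘ₗ LinearMap.applyₗ (D.d j : A)
  have hg : ∀ φ, g φ = ∑ j, φ (D.d j) • D.c j := fun φ => by simp [g]
  refine ⟨g ∘ₗ σ, fun φ => ?_⟩
  rw [LinearMap.comp_apply, hg]
  refine Finset.sum_congr rfl fun j _ => ?_
  -- Independence of the chosen section `σ`: `φ (d j)` depends on `φ` only through `left φ`, because
  -- `d j = right p`.
  obtain ⟨p, hp⟩ := D.right_bijective.2 (D.d j)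
  have h1 : D.left (σ (D.left φ)) = D.left φ := congrArg (fun g => g (D.left φ)) hσ
  rw [← hp, apply_right, apply_right, h1]

/-- Conjugation `x ↦ R⁻¹ (1 ⊗ x) R`. -/
def conj (R : (A ⊗[k] A)ˣ) : A →ₐ[k] A ⊗[k] A :=
  AlgHom.ofLinearMap (LinearMap.mulRight k (R : A ⊗[k] A) ∘ₗ
    LinearMap.mulLeft k (↑R⁻¹ : A ⊗[k] A) ∘ₗ TensorProduct.mk k A A 1)
    (by simp [← Algebra.TensorProduct.one_def])
    (fun x y => by
      have h1 : (1 : A) ⊗ₜ[k] (x * y) = (1 ⊗ₜ x) * (1 ⊗ₜ y) := by simp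
      simp only [LinearMap.comp_apply, TensorProduct.mk_apply, LinearMap.mulLeft_apply,
        LinearMap.mulRight_apply, h1, mul_assoc, Units.mul_inv_cancel_left])

theorem conj_apply (R : (A ⊗[k] A)ˣ) (x : A) :
    conj R x = (↑R⁻¹ : A ⊗[k] A) * ((1 : A) ⊗ₜ[k] x) * (R : A ⊗[k] A) := rfl

theorem conj_left (hpent : IsPentagon (R : A ⊗[k] A)) (φ : Module.Dual k A) :
    conj R (D.left φ) = Algebra.TensorProduct.map D.P.val D.P.val
      (∑ i, ∑ j, φ (D.b i * D.b j : D.H) • (D.a i ⊗ₜ[k] D.a j)) := by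
  rw [conj_apply, coe_left, hpent.conj_one_tmul D.sum_ab]
  simp

/-- By `conj_left` conjugation carries `P` into the image of `P ⊗ P`, which embeds in `A ⊗ A` over a
field. -/
theorem exists_comul (hpent : IsPentagon (R : A ⊗[k] A)) :
    ∃ δ : D.P →ₐ[k] D.P ⊗[k] D.P,
    (∀ x, Algebra.TensorProduct.map D.P.val D.P.val (δ x) = conj R x) ∧
    ∀ φ : Module.Dual k A,
      δ (D.left φ) = ∑ i, ∑ j, φ (D.b i * D.b j : D.H) • (D.a i ⊗ₜ[k] D.a j) := by
  let ι := Algebra.TensorProduct.map D.P.val D.P.val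
  have hι : Function.Injective ι := map_val_injective D.P D.P
  let e := AlgEquiv.ofInjective ι hι
  let δ : D.P →ₐ[k] D.P ⊗[k] D.P := e.symm.toAlgHom.comp
    (((conj R).comp D.P.val).codRestrict ι.range fun x => by
      obtain ⟨φ, rfl⟩ := D.left_surjective x
      exact ⟨_, (D.conj_left hpent φ).symm⟩)
  have hδ : ∀ x, ι (δ x) = conj R x := fun x =>
    congrArg Subtype.val (e.apply_symm_apply _)
  exact ⟨δ, hδ, fun φ => hι ((hδ _).trans (D.conj_left hpent φ))⟩

theorem exists_counit [Nontrivial A] (hpent : IsPentagon (R : A ⊗[k] A))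
    (hunit : (1 : A) ∈ rightCoeff (R : A ⊗[k] A)) :
    ∃ ε : D.P →ₐ[k] k, ∀ φ : Module.Dual k A, ε (D.left φ) = φ 1 := by
  obtain ⟨ε₀, hε₀⟩ := hunit
  rw [contractFst_eq_sum D.sum_ab] at hε₀
  have h1 : ∀ φ : Module.Dual k A, ε₀ (D.left φ) = φ 1 := by
    intro φ
    rw [← hε₀, coe_left]
    simp [mul_comm]
  have hmul : ∀ x y : D.P, ε₀ (x * y : D.P) = ε₀ x * ε₀ y := by
    intro x y
    obtain ⟨φ, rfl⟩ := D.left_surjective x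
    obtain ⟨ψ, rfl⟩ := D.left_surjective y
    -- The right coefficient at `ε₀` is `1`, and conjugation fixes `1 ⊗ 1`; pairing with `φ ⊗ ψ` is
    -- multiplicativity of `ε₀` on `P`.
    have h2 := congrArg (tensorForm φ ψ) (hpent.conj_tmul_one D.sum_ab ε₀)
    rw [hε₀, ← Algebra.TensorProduct.one_def, mul_one, Units.mul_inv,
      Algebra.TensorProduct.one_def, tensorForm_tmul] at h2
    rw [h1, h1, h2, MulMemClass.coe_mul, coe_left, coe_left, Finset.sum_mul_sum]
    simp [mul_comm, mul_left_comm]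
  -- Multiplicativity gives `ε₀(1) φ(1) = φ(1)`; since `A` is nonzero, some `φ` has `φ(1) ≠ 0`.
  have hone : ε₀ (1 : D.P) = 1 := by
    obtain ⟨φ, hφ⟩ : ∃ φ : Module.Dual k A, φ 1 ≠ 0 := by
      by_contra! hcon
      exact one_ne_zero ((Module.forall_dual_apply_eq_zero_iff k (1 : A)).1 hcon)
    have h2 := hmul 1 (D.left φ)
    rw [one_mul, h1] at h2
    exact mul_right_cancel₀ hφ (by rw [← h2, one_mul])
  exact ⟨AlgHom.ofLinearMap (ε₀ ∘ₗ D.P.val.toLinearMap) hone hmul, h1⟩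

end Factorization

end Factorization

/-! ### Transport of a Hopf structure along an algebra isomorphism. -/

section Transport

variable {k : Type*} {L B : Type*} [Field k] [Ring L] [HopfAlgebra k L] [Ring B] [Algebra k B]

/-- The Hopf algebra structure transported along an isomorphism of algebras. -/
def HopfStructure.ofAlgEquiv (e : L ≃ₐ[k] B) : HopfStructure k B where
  comul := ((Algebra.TensorProduct.map (e : L →ₐ[k] B) (e : L →ₐ[k] B)).comp
    (Bialgebra.comulAlgHom k L)).comp (e.symm : B →ₐ[k] L)
  counit := (Bialgebra.counitAlgHom k L).comp (e.symm : B →ₐ[k] L)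
  antipode := e.toLinearMap ∘ₗ HopfAlgebra.antipode k ∘ₗ e.symm.toLinearMap
  coassoc := by
    refine AlgHom.ext fun y => ?_
    obtain ⟨x, rfl⟩ := e.surjective y
    set E : L →ₐ[k] B := (e : L →ₐ[k] B)
    set Δ : L →ₐ[k] L ⊗[k] L := Bialgebra.comulAlgHom k L
    have h1 : ((Algebra.TensorProduct.assoc k k k B B B).toAlgHom.comp
        ((Algebra.TensorProduct.map (((Algebra.TensorProduct.map E E).comp Δ).comp
          (e.symm : B →ₐ[k] L)) (.id k B)).comp (Algebra.TensorProduct.map E E))) =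
        (Algebra.TensorProduct.map E (Algebra.TensorProduct.map E E)).comp
          ((Algebra.TensorProduct.assoc k k k L L L).toAlgHom.comp
            (Algebra.TensorProduct.map Δ (.id k L))) := by
      have h0 : (Algebra.TensorProduct.assoc k k k B B B).toAlgHom.comp
          (Algebra.TensorProduct.map (Algebra.TensorProduct.map E E) E) =
          (Algebra.TensorProduct.map E (Algebra.TensorProduct.map E E)).comp
            (Algebra.TensorProduct.assoc k k k L L L).toAlgHom := by
        ext <;> simp [Algebra.TensorProduct.one_def]
      rw [← AlgHom.comp_assoc _ _ (Algebra.TensorProduct.map Δ (.id k L)), ← h0,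
        AlgHom.comp_assoc]
      ext z <;> simp [E]
    have h2 : (Algebra.TensorProduct.map (.id k B) (((Algebra.TensorProduct.map E E).comp Δ).comp
          (e.symm : B →ₐ[k] L))).comp (Algebra.TensorProduct.map E E) =
        (Algebra.TensorProduct.map E (Algebra.TensorProduct.map E E)).comp
          (Algebra.TensorProduct.map (.id k L) Δ) := by
      ext z <;> simp [E]
    have h3 := congrArg (Algebra.TensorProduct.map E (Algebra.TensorProduct.map E E))
      (Coalgebra.coassoc_apply (R := k) x)
    have h4 := congrArg (fun g => g (Δ x)) h1
    have h5 := congrArg (fun g => g (Δ x)) h2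
    have h6 : (((Algebra.TensorProduct.map E E).comp Δ).comp (e.symm : B →ₐ[k] L)) (e x) =
        Algebra.TensorProduct.map E E (Δ x) := by simp
    simp only [AlgHom.comp_apply] at h4 h5 h6 ⊢
    rw [h6]
    exact h4.trans (h3.trans h5.symm)
  rTensor_counit := by
    refine AlgHom.ext fun y => ?_
    obtain ⟨x, rfl⟩ := e.surjective y
    have h1 : (Algebra.TensorProduct.map ((Bialgebra.counitAlgHom k L).comp
        (e.symm : B →ₐ[k] L)) (.id k B)).comp (Algebra.TensorProduct.map (e : L →ₐ[k] B) e) =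
        (Algebra.TensorProduct.map (.id k k) (e : L →ₐ[k] B)).comp
          (Algebra.TensorProduct.map (Bialgebra.counitAlgHom k L) (.id k L)) := by
      ext z <;> simp
    have h2 := congrArg (fun g => g (Coalgebra.comul (R := k) x)) h1
    have h3 := congrArg (Algebra.TensorProduct.map (.id k k) (e : L →ₐ[k] B))
      (Coalgebra.rTensor_counit_comul (R := k) x)
    have h4 : (e.symm : B →ₐ[k] L) (e x) = x := e.symm_apply_apply x
    simp only [AlgHom.comp_apply] at h2 ⊢
    rw [h4]
    exact h2.trans h3
  lTensor_counit := by
    refine AlgHom.ext fun y => ?_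
    obtain ⟨x, rfl⟩ := e.surjective y
    have h1 : (Algebra.TensorProduct.map (.id k B) ((Bialgebra.counitAlgHom k L).comp
        (e.symm : B →ₐ[k] L))).comp (Algebra.TensorProduct.map (e : L →ₐ[k] B) e) =
        (Algebra.TensorProduct.map (e : L →ₐ[k] B) (.id k k)).comp
          (Algebra.TensorProduct.map (.id k L) (Bialgebra.counitAlgHom k L)) := by
      ext z <;> simp
    have h2 := congrArg (fun g => g (Coalgebra.comul (R := k) x)) h1
    have h3 := congrArg (Algebra.TensorProduct.map (e : L →ₐ[k] B) (.id k k))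
      (Coalgebra.lTensor_counit_comul (R := k) x)
    have h4 : (e.symm : B →ₐ[k] L) (e x) = x := e.symm_apply_apply x
    simp only [AlgHom.comp_apply] at h2 ⊢
    rw [h4]
    exact h2.trans h3
  mul_antipode_rTensor_comul := by
    refine LinearMap.ext fun y => ?_
    obtain ⟨x, rfl⟩ := e.surjective y
    have h1 : ∀ t : L ⊗[k] L, LinearMap.mul' k B ((e.toLinearMap ∘ₗ HopfAlgebra.antipode k ∘ₗ
        e.symm.toLinearMap).rTensor B (Algebra.TensorProduct.map (e : L →ₐ[k] B) e t)) =
        e (LinearMap.mul' k L ((HopfAlgebra.antipode k).rTensor L t)) := by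
      intro t
      induction t using TensorProduct.induction_on with
      | zero => simp
      | tmul a b => simp
      | add a b ha hb => simp only [map_add, ha, hb]
    have h2 := h1 (Coalgebra.comul x)
    rw [HopfAlgebra.mul_antipode_rTensor_comul_apply] at h2
    have h4 : (e.symm : B →ₐ[k] L) (e x) = x := e.symm_apply_apply x
    simp only [LinearMap.comp_apply, AlgHom.toLinearMap_apply, AlgHom.comp_apply]
    rw [h4]
    exact h2.trans (e.commutes _)
  mul_antipode_lTensor_comul := by
    refine LinearMap.ext fun y => ?_
    obtain ⟨x, rfl⟩ := e.surjective y
    have h1 : ∀ t : L ⊗[k] L, LinearMap.mul' k B ((e.toLinearMap ∘ₗ HopfAlgebra.antipode k ∘ₗ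
        e.symm.toLinearMap).lTensor B (Algebra.TensorProduct.map (e : L →ₐ[k] B) e t)) =
        e (LinearMap.mul' k L ((HopfAlgebra.antipode k).lTensor L t)) := by
      intro t
      induction t using TensorProduct.induction_on with
      | zero => simp
      | tmul a b => simp
      | add a b ha hb => simp only [map_add, ha, hb]
    have h2 := h1 (Coalgebra.comul x)
    rw [HopfAlgebra.mul_antipode_lTensor_comul_apply] at h2
    have h4 : (e.symm : B →ₐ[k] L) (e x) = x := e.symm_apply_apply x
    simp only [LinearMap.comp_apply, AlgHom.toLinearMap_apply, AlgHom.comp_apply]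
    rw [h4]
    exact h2.trans (e.commutes _)

theorem HopfStructure.ofAlgEquiv_comul (e : L ≃ₐ[k] B) (x : L) :
    (HopfStructure.ofAlgEquiv e).comul (e x) = Algebra.TensorProduct.map (e : L →ₐ[k] B)
      (e : L →ₐ[k] B) (Coalgebra.comul (R := k) x) := by
  change Algebra.TensorProduct.map _ _ (Coalgebra.comul (e.symm (e x))) = _
  rw [e.symm_apply_apply]

/-- An isomorphism of algebras, as an isomorphism onto the transported Hopf algebra. -/
def HopfStructure.bialgEquiv (e : L ≃ₐ[k] B) :
    letI := (HopfStructure.ofAlgEquiv e).toHopfAlgebra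
    L ≃ₐc[k] B :=
  letI := (HopfStructure.ofAlgEquiv e).toHopfAlgebra
  BialgEquiv.ofAlgEquiv e
    (AlgHom.ext fun x => congrArg (Coalgebra.counit (R := k)) (e.symm_apply_apply x))
    (AlgHom.ext fun x => (HopfStructure.ofAlgEquiv_comul e x).symm)

end Transport

/-! ### The Hopf algebra axioms for `P`. -/

section Factorization

variable {k : Type u} {A : Type v} [Field k] [Ring A] [Algebra k A]

namespace Factorization

variable {R : (A ⊗[k] A)ˣ} (D : Factorization R)

theorem sum_apply_mul_smul_left (φ : Module.Dual k A) (y : A) :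
    ∑ i, φ (D.b i * y) • D.a i = D.left (φ ∘ₗ LinearMap.mulRight k y) := by
  simp [left_apply]

theorem sum_apply_mul_smul_right (φ : Module.Dual k A) (y : A) :
    ∑ i, φ (y * D.b i) • D.a i = D.left (φ ∘ₗ LinearMap.mulLeft k y) := by
  simp [left_apply]

/-- The contraction of `R⁻¹ R = 1` at `φ`; it becomes one of the two antipode axioms, the other
being `sum_mul_inv`. -/
theorem sum_inv_mul (φ : Module.Dual k A) :
    ∑ i, ∑ j, φ (D.d i * D.b j) • (D.c i * D.a j) = φ 1 • (1 : D.P) := by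
  have h1 : (↑R⁻¹ : A ⊗[k] A) * (R : A ⊗[k] A) = 1 := R.inv_mul
  rw [← D.sum_ab, ← D.sum_cd, Finset.sum_mul_sum, Algebra.TensorProduct.one_def] at h1
  have h2 := congrArg (contractSnd φ) h1
  simp only [Algebra.TensorProduct.tmul_mul_tmul, map_sum, contractSnd_tmul] at h2
  exact Subtype.ext (by simpa using h2)

theorem sum_mul_inv (φ : Module.Dual k A) :
    ∑ i, ∑ j, φ (D.b i * D.d j) • (D.a i * D.c j) = φ 1 • (1 : D.P) := by
  have h1 : (R : A ⊗[k] A) * (↑R⁻¹ : A ⊗[k] A) = 1 := R.mul_inv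
  rw [← D.sum_ab, ← D.sum_cd, Finset.sum_mul_sum, Algebra.TensorProduct.one_def] at h1
  have h2 := congrArg (contractSnd φ) h1
  simp only [Algebra.TensorProduct.tmul_mul_tmul, map_sum, contractSnd_tmul] at h2
  exact Subtype.ext (by simpa using h2)

theorem exists_hopfStructure [Nontrivial A] (hpent : IsPentagon (R : A ⊗[k] A))
    (hunit : (1 : A) ∈ rightCoeff (R : A ⊗[k] A)) :
    ∃ hopf : HopfStructure k D.P, IsLeftHopf R D.P hopf ∧
      (∀ φ : Module.Dual k A, hopf.comul (D.left φ) =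
        ∑ i, ∑ j, φ (D.b i * D.b j : D.H) • (D.a i ⊗ₜ[k] D.a j)) ∧
      ∀ φ : Module.Dual k A, hopf.counit (D.left φ) = φ 1 := by
  obtain ⟨δ, hδ, hδ'⟩ := D.exists_comul hpent
  obtain ⟨ε, hε⟩ := D.exists_counit hpent hunit
  obtain ⟨S, hS⟩ := D.exists_antipode
  -- Grouping the double sum by one index makes one tensor factor again of the form `left _`, where
  -- `δ`, `ε` and `S` are known.
  have hδl : ∀ φ : Module.Dual k A, δ (D.left φ) =
      ∑ j, D.left (φ ∘ₗ LinearMap.mulRight k (D.b j : A)) ⊗ₜ[k] D.a j := by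
    intro φ
    rw [hδ', Finset.sum_comm]
    simp only [← sum_apply_mul_smul_left, TensorProduct.sum_tmul, TensorProduct.smul_tmul',
      MulMemClass.coe_mul]
  have hδr : ∀ φ : Module.Dual k A, δ (D.left φ) =
      ∑ i, D.a i ⊗ₜ[k] D.left (φ ∘ₗ LinearMap.mulLeft k (D.b i : A)) := by
    intro φ
    rw [hδ']
    simp only [← sum_apply_mul_smul_right, TensorProduct.tmul_sum, TensorProduct.tmul_smul,
      MulMemClass.coe_mul]
  refine ⟨⟨δ, ε, S, ?_, ?_, ?_, ?_, ?_⟩, ⟨D.toSubmodule_P, hδ⟩, hδ', hε⟩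
  -- Both sides expand into triple sums with scalars `φ((b b') b'')` and `φ(b (b' b''))`:
  -- coassociativity of `P` is associativity of `H`.
  · refine AlgHom.ext fun x => ?_
    obtain ⟨φ, rfl⟩ := D.left_surjective x
    simp only [AlgHom.comp_apply]
    conv_lhs => rw [hδl]
    conv_rhs => rw [hδr]
    simp only [map_sum, Algebra.TensorProduct.map_tmul, hδ', TensorProduct.sum_tmul,
      TensorProduct.tmul_sum, TensorProduct.smul_tmul', AlgHom.id_apply]
    rw [Finset.sum_comm]
    refine Finset.sum_congr rfl fun i _ => ?_
    rw [Finset.sum_comm]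
    refine Finset.sum_congr rfl fun j _ => Finset.sum_congr rfl fun l _ => ?_
    simp [← TensorProduct.smul_tmul', mul_assoc]
  · refine AlgHom.ext fun x => ?_
    obtain ⟨φ, rfl⟩ := D.left_surjective x
    change _ = 1 ⊗ₜ[k] D.left φ
    simp only [AlgHom.comp_apply, hδl, map_sum, Algebra.TensorProduct.map_tmul, hε,
      AlgHom.id_apply, LinearMap.comp_apply, LinearMap.mulRight_apply, one_mul]
    rw [left_apply, TensorProduct.tmul_sum]
    exact Finset.sum_congr rfl fun i _ => by
      rw [TensorProduct.tmul_smul, TensorProduct.smul_tmul', smul_eq_mul, mul_one]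
  · refine AlgHom.ext fun x => ?_
    obtain ⟨φ, rfl⟩ := D.left_surjective x
    change _ = D.left φ ⊗ₜ[k] 1
    simp only [AlgHom.comp_apply, hδr, map_sum, Algebra.TensorProduct.map_tmul, hε,
      AlgHom.id_apply, LinearMap.comp_apply, LinearMap.mulLeft_apply, mul_one]
    rw [left_apply, TensorProduct.sum_tmul]
    exact Finset.sum_congr rfl fun i _ => by
      rw [TensorProduct.smul_tmul, smul_eq_mul, mul_one]
  · refine LinearMap.ext fun x => ?_
    obtain ⟨φ, rfl⟩ := D.left_surjective x
    simp only [LinearMap.comp_apply, AlgHom.toLinearMap_apply, hδl, map_sum, hε, hS,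
      LinearMap.rTensor_tmul, LinearMap.mul'_apply, LinearMap.mulRight_apply,
      Algebra.linearMap_apply, Algebra.algebraMap_eq_smul_one, Finset.sum_mul, smul_mul_assoc]
    rw [Finset.sum_comm]
    exact D.sum_inv_mul φ
  · refine LinearMap.ext fun x => ?_
    obtain ⟨φ, rfl⟩ := D.left_surjective x
    simp only [LinearMap.comp_apply, AlgHom.toLinearMap_apply, hδr, map_sum, hε, hS,
      LinearMap.lTensor_tmul, LinearMap.mul'_apply, LinearMap.mulLeft_apply,
      Algebra.linearMap_apply, Algebra.algebraMap_eq_smul_one, Finset.mul_sum, mul_smul_comm]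
    exact D.sum_mul_inv φ

end Factorization

end Factorization

/-! ### Duality `P^* ≅ H`, the Heisenberg map, and coinvariants. -/

section Factorization

open Coalgebra

variable {k : Type u} {A : Type v} [Field k] [Ring A] [Algebra k A]

/-- The algebra of left coefficients of `R` with the comultiplication dual to the multiplication of
right coefficients. -/
structure HopfFactorization (R : (A ⊗[k] A)ˣ) extends Factorization R where
  /-- The Hopf algebra structure. -/
  hopf : HopfStructure k P
  isLeftHopf : IsLeftHopf R P hopf
  hopf_comul_left : ∀ φ : Module.Dual k A, hopf.comul (toFactorization.left φ) =
    ∑ i, ∑ j, φ (b i * b j : H) • (a i ⊗ₜ[k] a j)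
  hopf_counit_left : ∀ φ : Module.Dual k A, hopf.counit (toFactorization.left φ) = φ 1

theorem IsPentagon.nonempty_hopfFactorization [Nontrivial A] {R : (A ⊗[k] A)ˣ}
    (h : IsPentagon (R : A ⊗[k] A)) (hu : IsUnitary (R : A ⊗[k] A)) :
    Nonempty (HopfFactorization R) := by
  obtain ⟨D⟩ := h.nonempty_factorization hu
  obtain ⟨hopf, h1, h2, h3⟩ := D.exists_hopfStructure h hu.2
  exact ⟨⟨D, hopf, h1, h2, h3⟩⟩

namespace HopfFactorization

open Factorization

variable {R : (A ⊗[k] A)ˣ} (D : HopfFactorization R)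

instance : HopfAlgebra k D.P := D.hopf.toHopfAlgebra

theorem comul_left (φ : Module.Dual k A) : comul (R := k) (D.left φ) =
    ∑ i, ∑ j, φ (D.b i * D.b j : D.H) • (D.a i ⊗ₜ[k] D.a j) := D.hopf_comul_left φ

theorem counit_left (φ : Module.Dual k A) : counit (R := k) (D.left φ) = φ 1 :=
  D.hopf_counit_left φ

/-- The isomorphism of algebras `P^* ≅ H`. -/
theorem exists_dualEquiv :
    ∃ f : HopfDual k D.P ≃ₐ[k] D.H, ∀ p, f p = D.right (HopfDual.equiv k D.P p) := by
  let g : HopfDual k D.P ≃ₗ[k] D.H :=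
    HopfDual.equiv k D.P ≪≫ₗ LinearEquiv.ofBijective D.right D.right_bijective
  have hg : ∀ p, g p = D.right (HopfDual.equiv k D.P p) := fun _ => rfl
  have happ : ∀ (φ : Module.Dual k A) (p : HopfDual k D.P), φ (g p) = p (D.left φ) := fun φ p => by
    rw [hg, apply_right, HopfDual.equiv_apply]
  refine ⟨AlgEquiv.ofLinearEquiv g ?_ ?_, hg⟩
  · refine Subtype.ext (eq_of_forall_dual (k := k) fun φ => ?_)
    rw [happ, HopfDual.one_apply, counit_left]
    rfl
  · intro p q
    refine Subtype.ext (eq_of_forall_dual (k := k) fun φ => ?_)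
    rw [happ, HopfDual.mul_apply, comul_left, MulMemClass.coe_mul, hg, hg, coe_right, coe_right,
      Finset.sum_mul_sum]
    simp [mul_comm, mul_left_comm]

/-- The comultiplication transported from `P^*` is `y ↦ R (y ⊗ 1) R⁻¹`. -/
theorem isRightHopf_ofAlgEquiv (hpent : IsPentagon (R : A ⊗[k] A))
    (f : HopfDual k D.P ≃ₐ[k] D.H) (hf : ∀ p, f p = D.right (HopfDual.equiv k D.P p)) :
    IsRightHopf R D.H (HopfStructure.ofAlgEquiv f) := by
  refine ⟨D.toSubmodule_H, fun y => ?_⟩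
  obtain ⟨p, rfl⟩ := f.surjective y
  obtain ⟨φ, hφ⟩ := D.exists_extend (HopfDual.equiv k D.P p)
  have h1 : ∀ t : HopfDual k D.P ⊗[k] HopfDual k D.P,
      Algebra.TensorProduct.map D.H.val D.H.val (Algebra.TensorProduct.map
        (f : HopfDual k D.P →ₐ[k] D.H) (f : HopfDual k D.P →ₐ[k] D.H) t) =
      ∑ i, ∑ j, dualPairing (D.a i) (D.a j) t • ((D.b i : A) ⊗ₜ[k] (D.b j : A)) := by
    intro t
    induction t using TensorProduct.induction_on with
    | zero => simp
    | tmul p q =>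
      simp [hf, coe_right, TensorProduct.sum_tmul, TensorProduct.tmul_sum, Finset.smul_sum,
        ← TensorProduct.smul_tmul', smul_smul, mul_comm]
      exact Finset.sum_comm
    | add a b ha hb => simp only [map_add, ha, hb, add_smul, Finset.sum_add_distrib]
  have h2 : ((f p : D.H) : A) = ∑ i, φ (D.a i) • (D.b i : A) := by
    rw [hf, coe_right]
    simp only [hφ]
  rw [HopfStructure.ofAlgEquiv_comul, h1, h2, hpent.conj_tmul_one D.sum_ab]
  simp only [HopfDual.comul_apply, dualPairing_dualComul, ← MulMemClass.coe_mul, hφ,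
    HopfDual.equiv_apply]

/-- The algebra map from the Heisenberg double of `P`. -/
theorem exists_heisenbergHom (hpent : IsPentagon (R : A ⊗[k] A))
    (f : HopfDual k D.P ≃ₐ[k] D.H) (hf : ∀ p, f p = D.right (HopfDual.equiv k D.P p)) :
    ∃ F : Heisenberg k D.P →ₐ[k] A, ∀ (x : D.P) (p : HopfDual k D.P),
      F (Heisenberg.smash x p) = (f p : A) * (x : A) := by
  let fA : HopfDual k D.P →ₐ[k] A := D.H.val.comp (f : HopfDual k D.P →ₐ[k] D.H)
  have hfA : ∀ p, fA p = ∑ i, p (D.a i) • (D.b i : A) := fun p => by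
    change ((f p : D.H) : A) = _
    rw [hf, coe_right]
    rfl
  let F₀ : Heisenberg k D.P →ₗ[k] A := TensorProduct.lift
    ((LinearMap.mul k A).flip.compl₁₂ D.P.val.toLinearMap fA.toLinearMap) ∘ₗ
      (Heisenberg.equiv k D.P).symm.toLinearMap
  have hF₀ : ∀ x p, F₀ (Heisenberg.smash x p) = fA p * (x : A) := fun _ _ => rfl
  -- The commutation rule for coefficients is exactly the product `(x # ε)(1 # q)`; `haux` extends
  -- it to all products, as the outer factors only multiply on the left and right.
  have hcomm : ∀ (x : D.P) (q : HopfDual k D.P),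
      (x : A) * fA q = F₀ (Heisenberg.smashAux 1 1 q (comul x)) := by
    intro x q
    obtain ⟨φ, rfl⟩ := D.left_surjective x
    obtain ⟨ψ, hψ⟩ := D.exists_extend (HopfDual.equiv k D.P q)
    have h1 := hpent.coeff_mul_coeff D.sum_ab ψ φ
    simp only [← MulMemClass.coe_mul, hψ, HopfDual.equiv_apply] at h1
    rw [coe_left, hfA, h1, comul_left]
    simp only [map_sum, map_smul, Heisenberg.smashAux_tmul, hF₀, one_mul, mul_one, hfA,
      Heisenberg.act_apply, Finset.sum_mul, Finset.smul_sum, smul_mul_assoc, smul_smul]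
    rw [Finset.sum_comm]
    refine Finset.sum_congr rfl fun j _ => ?_
    rw [Finset.sum_comm]
    simp only [mul_comm, MulMemClass.coe_mul]
  have haux : ∀ (p q : HopfDual k D.P) (g : D.P) (t : D.P ⊗[k] D.P),
      F₀ (Heisenberg.smashAux p g q t) = fA p * F₀ (Heisenberg.smashAux 1 1 q t) * (g : A) := by
    intro p q g t
    induction t using TensorProduct.induction_on with
    | zero => simp
    | tmul x y => simp [hF₀, mul_assoc]
    | add a b ha hb => simp only [map_add, ha, hb, mul_add, add_mul]
  refine ⟨AlgHom.ofLinearMap F₀ ?_ ?_, hF₀⟩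
  · rw [Heisenberg.one_def, hF₀]
    simp
  · intro s t
    induction s using Heisenberg.smash_induction with
    | zero => simp
    | add a b ha hb => simp only [add_mul, map_add, ha, hb]
    | smash h p =>
    induction t using Heisenberg.smash_induction with
    | zero => simp
    | add a b ha hb => simp only [mul_add, map_add, ha, hb]
    | smash g q =>
      rw [Heisenberg.smash_mul_smash, haux, ← hcomm, hF₀, hF₀]
      simp only [mul_assoc]

variable {D} {f : HopfDual k D.P ≃ₐ[k] D.H} {F : Heisenberg k D.P →ₐ[k] A}

theorem coe_sum_repr {ι : Type*} [Fintype ι] (e : Module.Basis ι k D.P) (x : D.P) :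
    ∑ i, e.repr x i • (e i : A) = x := by
  have h := congrArg D.P.val (e.sum_repr x)
  simpa only [map_sum, map_smul, Subalgebra.coe_val] using h

/-- Expanding each `D.a j` in the basis `e` collects the right factors into `f` of the dual basis.
Thus `R` is the canonical element of `P ⊗ P^*` carried over by `f`. -/
theorem sum_basis_tmul {ι : Type*} [Fintype ι] (e : Module.Basis ι k D.P)
    (hf : ∀ p, f p = D.right (HopfDual.equiv k D.P p)) :
    ∑ i, (e i : A) ⊗ₜ[k] (f (dualVec e i) : A) = (R : A ⊗[k] A) := by
  have h1 : ∀ i, (f (dualVec e i) : A) = ∑ j, e.repr (D.a j) i • (D.b j : A) := fun i => by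
    rw [hf, coe_right]
    rfl
  simp only [h1, TensorProduct.tmul_sum]
  rw [Finset.sum_comm, ← D.sum_ab]
  refine Finset.sum_congr rfl fun j _ => ?_
  simp only [← coe_sum_repr e (D.a j), TensorProduct.sum_tmul, TensorProduct.tmul_smul,
    TensorProduct.smul_tmul']

theorem map_canonical (hf : ∀ p, f p = D.right (HopfDual.equiv k D.P p))
    (hF : ∀ (x : D.P) (p : HopfDual k D.P), F (Heisenberg.smash x p) = (f p : A) * (x : A)) :
    Algebra.TensorProduct.map F F (Heisenberg.canonical k D.P) = (R : A ⊗[k] A) := by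
  rw [Heisenberg.canonical, coevaluation_apply_one, map_sum, map_sum,
    ← sum_basis_tmul (Module.Basis.ofVectorSpace k D.P) hf]
  refine Finset.sum_congr rfl fun i _ => ?_
  change F (Heisenberg.smash _ 1) ⊗ₜ[k] F (Heisenberg.smash 1 _) = _
  rw [hF, hF]
  simp
  rfl

theorem adjoin_le_range
    (hF : ∀ (x : D.P) (p : HopfDual k D.P), F (Heisenberg.smash x p) = (f p : A) * (x : A)) :
    Algebra.adjoin k ((D.P : Set A) ∪ (D.H : Set A)) ≤ F.range := by
  rw [Algebra.adjoin_le_iff]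
  rintro z (hz | hz)
  · exact ⟨Heisenberg.smash ⟨z, hz⟩ 1, by
      change F _ = _
      simp [hF]⟩
  · exact ⟨Heisenberg.smash 1 (f.symm ⟨z, hz⟩), by
      change F _ = _
      simp [hF]⟩

theorem finiteDimensional_adjoin
    (hF : ∀ (x : D.P) (p : HopfDual k D.P), F (Heisenberg.smash x p) = (f p : A) * (x : A)) :
    FiniteDimensional k (Algebra.adjoin k ((D.P : Set A) ∪ (D.H : Set A))) ∧
      Module.finrank k (Algebra.adjoin k ((D.P : Set A) ∪ (D.H : Set A))) ≤
        tensorLength (R : A ⊗[k] A) ^ 2 := by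
  have h1 : Subalgebra.toSubmodule (Algebra.adjoin k ((D.P : Set A) ∪ (D.H : Set A))) ≤
    LinearMap.range F.toLinearMap := adjoin_le_range hF
  have : FiniteDimensional k (Heisenberg k D.P) := (Heisenberg.equiv k D.P).finiteDimensional
  refine ⟨Submodule.finiteDimensional_of_le h1, (Submodule.finrank_mono h1).trans ?_⟩
  refine (LinearMap.finrank_range_le _).trans ?_
  rw [← (Heisenberg.equiv k D.P).finrank_eq, Module.finrank_tensorProduct, finrank_hopfDual, sq]
  exact Nat.mul_le_mul D.finrank_P_le D.finrank_P_le

/-- Translates coinvariance for `R` into the condition on `H = f(P^*)` that the module theorem takes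
as input: contract with an extension of `p` one way, expand `R` in a basis of `P` the other way. -/
theorem mem_rightCoinvariants_iff (hf : ∀ p, f p = D.right (HopfDual.equiv k D.P p)) (a : A) :
    a ∈ rightCoinvariants (R : A ⊗[k] A) ↔ ∀ p : HopfDual k D.P, a * (f p : A) = p 1 • a := by
  constructor
  · intro (h : (1 : A) ⊗ₜ[k] a * (R : A ⊗[k] A) = (1 : A) ⊗ₜ[k] a) p
    obtain ⟨φ, hφ⟩ := D.exists_extend (HopfDual.equiv k D.P p)
    have h1 := congrArg (contractFst φ) h
    rw [← D.sum_ab] at h1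
    have hone : φ 1 = p 1 := hφ 1
    simpa [Finset.mul_sum, hφ, hone, hf, coe_right] using h1
  · intro h
    change (1 : A) ⊗ₜ[k] a * (R : A ⊗[k] A) = (1 : A) ⊗ₜ[k] a
    let e := Module.finBasis k D.P
    rw [← sum_basis_tmul e hf]
    simp only [Finset.mul_sum, Algebra.TensorProduct.tmul_mul_tmul, one_mul, h,
      ← TensorProduct.smul_tmul, ← TensorProduct.sum_tmul]
    congr 1
    exact coe_sum_repr e 1

theorem mem_leftCoinvariants_iff
    (hf : ∀ p, f p = D.right (HopfDual.equiv k D.P p)) (a : A) :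
    a ∈ leftCoinvariants (R : A ⊗[k] A) ↔ ∀ x : D.P, (x : A) * a = counit (R := k) x • a := by
  constructor
  · intro (h : (R : A ⊗[k] A) * a ⊗ₜ[k] (1 : A) = a ⊗ₜ[k] (1 : A)) x
    obtain ⟨φ, rfl⟩ := D.left_surjective x
    have h1 := congrArg (contractSnd φ) h
    rw [← D.sum_ab] at h1
    simpa [Finset.sum_mul, counit_left, coe_left] using h1
  · intro h
    change (R : A ⊗[k] A) * a ⊗ₜ[k] (1 : A) = a ⊗ₜ[k] (1 : A)
    -- Since the unit of `P^*` is the counit, this reads `∑ ε(aᵢ) bᵢ = 1`.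
    have h1 := congrArg Subtype.val (map_one f)
    rw [hf, coe_right] at h1
    rw [← D.sum_ab]
    simp only [Finset.sum_mul, Algebra.TensorProduct.tmul_mul_tmul, mul_one, h,
      TensorProduct.smul_tmul, ← TensorProduct.tmul_sum]
    congr 1

end HopfFactorization

end Factorization

/-! ### Invariance of `P(A, R)` under algebra isomorphisms. -/

section Invariance

variable {k A B : Type*} [Field k] [Ring A] [Algebra k A] [Ring B] [Algebra k B]

theorem leftCoeff_map (f : A ≃ₐ[k] B) (t : A ⊗[k] A) :
    leftCoeff (Algebra.TensorProduct.map (f : A →ₐ[k] B) (f : A →ₐ[k] B) t) =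
      (leftCoeff t).map f.toLinearMap := by
  have h : ∀ φ : Module.Dual k B,
      contractSnd φ (Algebra.TensorProduct.map (f : A →ₐ[k] B) (f : A →ₐ[k] B) t) =
        f (contractSnd (φ ∘ₗ f.toLinearMap) t) := by
    intro φ
    induction t using TensorProduct.induction_on with
    | zero => simp
    | tmul a b => simp
    | add a b ha hb => simp only [map_add, ha, hb]
  ext y
  constructor
  · rintro ⟨φ, rfl⟩
    exact ⟨_, ⟨φ ∘ₗ f.toLinearMap, rfl⟩, (h φ).symm⟩
  · rintro ⟨_, ⟨φ, rfl⟩, rfl⟩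
    refine ⟨φ ∘ₗ f.symm.toLinearMap, ?_⟩
    rw [h]
    have hφ : (φ ∘ₗ f.symm.toLinearMap) ∘ₗ f.toLinearMap = φ :=
      LinearMap.ext fun x => congrArg φ (f.symm_apply_apply x)
    rw [hφ]
    rfl

/-- The image `f(P)` with the transported structure works: `f ⊗ f` is an algebra map, so it carries
conjugation by `R` to conjugation by `(f ⊗ f)(R)`. -/
theorem exists_isLeftHopf_mapUnit {R : (A ⊗[k] A)ˣ} {P : Subalgebra k A} (hopf : HopfStructure k P)
    (h : IsLeftHopf R P hopf) (f : A ≃ₐ[k] B) :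
    letI := hopf.toHopfAlgebra
    ∃ (P' : Subalgebra k B) (hopf' : HopfStructure k P'),
      letI := hopf'.toHopfAlgebra
      IsLeftHopf (mapUnit (f : A →ₐ[k] B) R) P' hopf' ∧ Nonempty (P ≃ₐc[k] P') := by
  let := hopf.toHopfAlgebra
  let e : P ≃ₐ[k] P.map (f : A →ₐ[k] B) := f.subalgebraMap P
  have he : ∀ x, (e x : B) = f x := fun _ => rfl
  refine ⟨P.map (f : A →ₐ[k] B), .ofAlgEquiv e, ⟨?_, fun y => ?_⟩, ⟨HopfStructure.bialgEquiv e⟩⟩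
  · change _ = leftCoeff (Algebra.TensorProduct.map (f : A →ₐ[k] B) (f : A →ₐ[k] B) (R : A ⊗[k] A))
    rw [leftCoeff_map, ← h.1]
    rfl
  · obtain ⟨x, rfl⟩ := e.surjective y
    have h1 : (Algebra.TensorProduct.map (P.map (f : A →ₐ[k] B)).val
        (P.map (f : A →ₐ[k] B)).val).comp (Algebra.TensorProduct.map (e : P →ₐ[k] _) e) =
        (Algebra.TensorProduct.map (f : A →ₐ[k] B) (f : A →ₐ[k] B)).comp
          (Algebra.TensorProduct.map P.val P.val) := by
      ext z <;> simp [he]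
    have h2 := congrArg (fun g => g (hopf.comul x)) h1
    rw [HopfStructure.ofAlgEquiv_comul]
    refine h2.trans ?_
    rw [AlgHom.comp_apply, h.2 x, map_mul, map_mul, he]
    simp [mapUnit]

theorem exists_mapUnit_eq_conj (R : (A ⊗[k] A)ˣ) (u : Aˣ) : ∃ f : A ≃ₐ[k] A,
    mapUnit (f : A →ₐ[k] A) R = unitTensor k u * R * (unitTensor k u)⁻¹ := by
  let f : A ≃ₐ[k] A := AlgEquiv.ofLinearEquiv
    (LinearEquiv.ofLinearMap
      (LinearMap.mulRight k (↑u⁻¹ : A) ∘ₗ LinearMap.mulLeft k (u : A))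
      (LinearMap.mulRight k (u : A) ∘ₗ LinearMap.mulLeft k (↑u⁻¹ : A))
      (LinearMap.ext fun x => by simp [mul_assoc]) (LinearMap.ext fun x => by simp [mul_assoc]))
    (by simp) (fun x y => by simp [mul_assoc])
  have hf : ∀ x, f x = u * x * (↑u⁻¹ : A) := fun _ => rfl
  refine ⟨f, Units.ext ?_⟩
  change Algebra.TensorProduct.map (f : A →ₐ[k] A) (f : A →ₐ[k] A) (R : A ⊗[k] A) =
    ((u : A) ⊗ₜ[k] (u : A)) * (R : A ⊗[k] A) * ((↑u⁻¹ : A) ⊗ₜ[k] (↑u⁻¹ : A))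
  induction (R : A ⊗[k] A) using TensorProduct.induction_on with
  | zero => simp
  | tmul a b => simp [hf]
  | add a b ha hb => simp only [map_add, ha, hb, mul_add, add_mul]

end Invariance

/-! ### Freeness as a right module. -/

section Free

variable {k A : Type*} [Field k] [Ring A] [Algebra k A]

theorem free_op_of_tensor_equiv (P : Subalgebra k A) (C : Submodule k A) (μ : C ⊗[k] P ≃ₗ[k] A)
    (hμ : ∀ (a : C) (x : P), μ (a ⊗ₜ[k] x) = (a : A) * (x : A)) : Module.Free P.op A := by
  classical
  let e := Module.Basis.ofVectorSpace k C
  let ν : (Module.Basis.ofVectorSpaceIndex k C →₀ P) ≃ₗ[k] A :=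
    (TensorProduct.equivFinsuppOfBasisLeft e).symm ≪≫ₗ μ
  have hν : ∀ i x, ν (Finsupp.single i x) = (e i : A) * (x : A) := fun i x => by
    simp [ν, hμ]
  -- A right `P`-module is a module over `P.op`, so a basis of `C` over `k` must be turned into one
  -- over `P.op`; `σ` is only additive because it reverses products.
  let σ : P.op ≃+ P :=
    { toFun := fun y => ⟨(y : Aᵐᵒᵖ).unop, y.2⟩
      invFun := fun x => ⟨.op x, x.2⟩
      left_inv := fun _ => rfl
      right_inv := fun _ => rfl
      map_add' := fun _ _ => rfl }
  let τ : (Module.Basis.ofVectorSpaceIndex k C →₀ P.op) ≃+ A :=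
    (Finsupp.mapRange.addEquiv σ).trans ν.toAddEquiv
  have hτ : ∀ i y, τ (Finsupp.single i y) = (e i : A) * (y : Aᵐᵒᵖ).unop := fun i y => by
    change ν (Finsupp.mapRange σ (map_zero σ) (Finsupp.single i y)) = _
    rw [Finsupp.mapRange_single, hν]
    rfl
  refine Module.Free.of_equiv (τ.toLinearEquiv fun y g => ?_)
  induction g using Finsupp.induction_linear with
  | zero => simp
  | add g h hg hh => rw [smul_add, map_add, map_add, smul_add, hg, hh]
  | single i z =>
    rw [Finsupp.smul_single, hτ, hτ, Subalgebra.smul_def, MulOpposite.smul_eq_mul_unop]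
    simp [mul_assoc]

end Free

end PentagonEq

end

/-! ### Assembly of the five statements. -/

open PentagonEq
theorem mainTheorem3 {k : Type*} {A : Type*} [Field k] [Ring A] [Algebra k A] [Nontrivial A]
    (R : (A ⊗[k] A)ˣ) (hpent : IsPentagon (R : A ⊗[k] A)) (hunit : IsUnitary (R : A ⊗[k] A)) :
    ∃ (P H : Subalgebra k A) (hopfP : HopfStructure k P) (hopfH : HopfStructure k H)
      (_ : FiniteDimensional k P) (_ : FiniteDimensional k H),
      letI := hopfP.toHopfAlgebra
      letI := hopfH.toHopfAlgebra
      -- 1) the Hopf algebras `P(A, R)` and `H(A, R)`, and the subalgebra they generate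
      (IsLeftHopf R P hopfP ∧ IsRightHopf R H hopfH ∧
        FiniteDimensional k (Algebra.adjoin k ((P : Set A) ∪ (H : Set A))) ∧
        Module.finrank k (Algebra.adjoin k ((P : Set A) ∪ (H : Set A))) ≤
          tensorLength (R : A ⊗[k] A) ^ 2) ∧
      (∃ RPH : P ⊗[k] H, Algebra.TensorProduct.map P.val H.val RPH = (R : A ⊗[k] A) ∧
        -- 2) the isomorphism `P^* ≅ H`
        (∃ f : HopfDual k P ≃ₐc[k] H,
          ∀ p : HopfDual k P, f p = contractFst (HopfDual.equiv k P p) RPH) ∧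
        -- 3) the algebra map from the Heisenberg double
        (∃ F : Heisenberg k P →ₐ[k] A,
          (∀ (x : P) (p : HopfDual k P), F (Heisenberg.smash x p) =
            ((contractFst (HopfDual.equiv k P p) RPH : H) : A) * (x : A)) ∧
          Algebra.TensorProduct.map F F (Heisenberg.canonical k P) = (R : A ⊗[k] A))) ∧
      -- 4) `A` as a right `P`-module and as a left `H`-module
      ((∃ μ : (rightCoinvariants (R : A ⊗[k] A) ⊗[k] P) ≃ₗ[k] A,
          (∀ (a : rightCoinvariants (R : A ⊗[k] A)) (x : P), μ (a ⊗ₜ[k] x) = (a : A) * (x : A)) ∧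
          (∀ (t : rightCoinvariants (R : A ⊗[k] A) ⊗[k] P) (y : P),
            μ ((LinearMap.mulRight k y).lTensor _ t) = μ t * (y : A))) ∧
        (∃ μ : (H ⊗[k] leftCoinvariants (R : A ⊗[k] A)) ≃ₗ[H] A,
          ∀ (y : H) (a : leftCoinvariants (R : A ⊗[k] A)), μ (y ⊗ₜ[k] a) = (y : A) * (a : A)) ∧
        Module.Free P.op A ∧ Module.Free H A ∧
        (FiniteDimensional k A →
          0 < Module.finrank k (leftCoinvariants (R : A ⊗[k] A)) ∧
          0 < Module.finrank k (rightCoinvariants (R : A ⊗[k] A)) ∧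
          Module.finrank k P = Module.finrank k H ∧
          (Module.finrank k H : ℚ) = (Module.finrank k A : ℚ) /
            (Module.finrank k (leftCoinvariants (R : A ⊗[k] A)) : ℚ) ∧
          (Module.finrank k P : ℚ) = (Module.finrank k A : ℚ) /
            (Module.finrank k (rightCoinvariants (R : A ⊗[k] A)) : ℚ))) ∧
      -- 5) invariance under algebra isomorphisms, and in particular under conjugation
      ((∀ {B : Type*} [Ring B] [Algebra k B] (f : A ≃ₐ[k] B),
          ∃ (P' : Subalgebra k B) (hopfP' : HopfStructure k P'),
            letI := hopfP'.toHopfAlgebra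
            IsLeftHopf (mapUnit (f : A →ₐ[k] B) R) P' hopfP' ∧ Nonempty (P ≃ₐc[k] P')) ∧
        (∀ u : Aˣ, ∃ (P' : Subalgebra k A) (hopfP' : HopfStructure k P'),
            letI := hopfP'.toHopfAlgebra
            IsLeftHopf (unitTensor k u * R * (unitTensor k u)⁻¹) P' hopfP' ∧
              Nonempty (P ≃ₐc[k] P'))) := by
  obtain ⟨D⟩ := hpent.nonempty_hopfFactorization hunit
  obtain ⟨f, hf⟩ := D.exists_dualEquiv
  obtain ⟨F, hF⟩ := D.exists_heisenbergHom hpent f hf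
  have hH := D.isRightHopf_ofAlgEquiv hpent f hf
  have hRPH : ∀ p : HopfDual k D.P, f p =
      contractFst (HopfDual.equiv k D.P p) (∑ i, D.a i ⊗ₜ[k] D.b i) := fun p => by
    rw [hf, D.right_apply]
    simp
  have hFP : ∀ x : D.P, F (Heisenberg.smash x 1) = x := fun x => by simp [hF]
  have hFH : ∀ p : HopfDual k D.P, F (Heisenberg.smash 1 p) = f p := fun p => by simp [hF]
  obtain ⟨μ, hμ⟩ := exists_coinvariants_tensor_equiv F (rightCoinvariants (R : A ⊗[k] A))
    (fun a => by
      simp only [hFH]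
      exact HopfFactorization.mem_rightCoinvariants_iff hf a)
  obtain ⟨ν, hν⟩ := exists_tensor_coinvariants_equiv F (leftCoinvariants (R : A ⊗[k] A))
    (fun a => by
      simp only [hFP]
      exact HopfFactorization.mem_leftCoinvariants_iff hf a)
  simp only [hFP] at hμ
  simp only [hFH] at hν
  -- The module theorem decomposes `A` over `P^*`; `f` replaces `P^*` by `H`.
  let ν₀ : D.H ⊗[k] leftCoinvariants (R : A ⊗[k] A) ≃ₗ[k] A :=
    TensorProduct.congr f.symm.toLinearEquiv (LinearEquiv.refl k _) ≪≫ₗ ν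
  have hν₀ : ∀ (y : D.H) (a : leftCoinvariants (R : A ⊗[k] A)),
      ν₀ (y ⊗ₜ a) = (y : A) * (a : A) := fun y a => by
    simp [ν₀, hν]
  let ν₁ : D.H ⊗[k] leftCoinvariants (R : A ⊗[k] A) ≃ₗ[D.H] A :=
    { ν₀ with
      map_smul' := fun y t => by
        change ν₀ (y • t) = y • ν₀ t
        induction t using TensorProduct.induction_on with
        | zero => simp
        | tmul z a =>
          rw [TensorProduct.smul_tmul', hν₀, hν₀, Subalgebra.smul_def]
          simp [mul_assoc]
        | add s t hs ht => rw [smul_add, map_add, map_add, smul_add, hs, ht] }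
  refine ⟨D.P, D.H, D.hopf, .ofAlgEquiv f, inferInstance, inferInstance,
    ⟨D.isLeftHopf, hH, HopfFactorization.finiteDimensional_adjoin hF⟩,
    ⟨∑ i, D.a i ⊗ₜ[k] D.b i, ?_, ⟨HopfStructure.bialgEquiv f, hRPH⟩, ⟨F, ?_, ?_⟩⟩,
    ⟨⟨μ, hμ, ?_⟩, ⟨ν₁, hν₀⟩, free_op_of_tensor_equiv D.P _ μ hμ, .of_equiv ν₁, ?_⟩, ?_, ?_⟩
  · rw [map_sum]
    exact D.sum_ab
  · intro x p
    rw [hF, hRPH]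
  · exact HopfFactorization.map_canonical hf hF
  · intro t y
    induction t using TensorProduct.induction_on with
    | zero => simp
    | tmul a x => simp [hμ, mul_assoc]
    | add s t hs ht => rw [map_add, map_add, map_add, hs, ht, add_mul]
  · intro hfin
    have h1 := μ.finrank_eq
    have h2 := ν₀.finrank_eq
    rw [Module.finrank_tensorProduct] at h1 h2
    have hA : 0 < Module.finrank k A := Module.finrank_pos
    -- A zero factor would make `dim A = 0`, contrary to `A ≠ 0`.
    have hl : 0 < Module.finrank k (leftCoinvariants (R : A ⊗[k] A)) :=
      Nat.pos_of_ne_zero fun h => by rw [h] at h2; omega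
    have hr : 0 < Module.finrank k (rightCoinvariants (R : A ⊗[k] A)) :=
      Nat.pos_of_ne_zero fun h => by rw [h] at h1; omega
    refine ⟨hl, hr, ?_, ?_, ?_⟩
    · rw [← f.toLinearEquiv.finrank_eq, finrank_hopfDual]
    · rw [eq_div_iff (by exact_mod_cast hl.ne'), ← h2]
      push_cast
      ring
    · rw [eq_div_iff (by exact_mod_cast hr.ne'), ← h1]
      push_cast
      ring
  · intro B _ _ g
    exact exists_isLeftHopf_mapUnit D.hopf D.isLeftHopf g
  · intro u
    obtain ⟨g, hg⟩ := exists_mapUnit_eq_conj R u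
    rw [← hg]
    exact exists_isLeftHopf_mapUnit D.hopf D.isLeftHopf g
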